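/- **Setting.** Let $T>0$ and let $(\Omega,\mathcal F,(\mathcal F_t)_{t\in[0,T]},\mathbb P)$ be a filtered probability space with a right-continuous and complete filtration such that $\mathcal F_0$ is trivial modulo $\mathbb P$ and $\mathcal F_T=\mathcal F$. Let $\mathcal O$ be the optional $\sigma$-algebra on $[0,T]\times\Omega$, and let $\kappa$ be the measure on $[0,T]$ with $d\kappa_t=dt$ on $[0,T)$ and $\kappa(\{T\})=1$. Let $L^\infty$ be the space of $(\kappa\otimes\mathbb P)$-essentially bounded $\mathcal O$-measurable processes; (in)equalities between processes are understood $(\kappa\otimes\mathbb P)$-a.e. A finitely-additive probability $\mathbb Q$ is a positive element of the dual $(L^\infty)^*$ with $\langle\mathbb Q,1\rangle=1$; we write $\mathbb Q[A]=\langle\mathbb Q,1_A\rangle$ for $A\in\mathcal O$. There are $d\ge 1$ agents. For each $i=1,\dots,d$ the following are given. * An endowment: an optional process $e^i$ with $\varepsilon\le e^i\le 1/\varepsilon$ for some $\varepsilon>0$. * A withdrawal cap: an adapted càdlàg $(0,\infty]$-valued process $\Gamma^i$ with $\Gamma^i>e^i$ and $\Gamma^i_T=\infty$ a.s. * A utility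 function $U^i:[0,T]\times(0,\infty)\to\mathbb R$, Borel measurable in $t$, such that $U^i(t,\cdot)$ is strictly concave, continuously differentiable and strictly increasing for each $t$, and $U^i(\cdot,x)$ is bounded for each $x>0$. It is assumed that $U^i_x(t,\cdot)$ maps $(0,\infty)$ onto $(0,\infty)$, and that its inverse $I^i(t,\cdot):(0,\infty)\to(0,\infty)$ satisfies $\lim_{y\to\infty}I^i(t,y)=0$ and $\lim_{y\to0}I^i(t,y)=\infty$, both uniformly in $t\in[0,T]$. Moreover $I^i$ is continuously differentiable in $y$ and locally convexity-Lipschitz: for all $0<y_1<y_2$ there is a constant $C$ such that for all $s,t\in[0,T]$ the function $f=I^i(t,\cdot)-I^i(s,\cdot)$ satisfies $|f(y_1)|+|f'(y_1)|+\mathrm{TV}(f';[y_1,y_2])\le C|t-s|$. Put $U^i(t,0)=\lim_{x\downarrow0}U^i(t,x)\in[-\infty,\infty)$. For an optional process $c\ge0$ let $\mathbb U^i(c)=\mathbb E\int_0^T U^i(t,c_t)\,d\kappa_t$ if $\mathbb E\int_0^T\min(0,U^i(t,c_t))\,d\kappa_t>-\infty$, and $\mathbb U^i(c)=-\infty$ otherwise.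 The budget set of agent $i$ is $B^i(\mathbb Q)=\{c\in L^\infty: 0\le c\le\Gamma^i,\ \langle\mathbb Q,c\rangle\le\langle\mathbb Q,e^i\rangle\}$. An *abstract equilibrium* is a pair $(\mathbb Q,(c^i)_{i=1,\dots,d})$ of a finitely-additive probability $\mathbb Q$ and processes $c^i\in B^i(\mathbb Q)$ such that $\sum_i c^i=\sum_i e^i$ and $\mathbb U^i(c^i)\ge\mathbb U^i(c)$ for all $c\in B^i(\mathbb Q)$ and all $i$. **Statement.** Let $(\mathbb Q,(c^i)_{i=1,\dots,d})$ be an abstract equilibrium. Then $\mathbb Q$ has an optional density with respect to $\kappa\otimes\mathbb P$, that is, there is an $\mathcal O$-measurable, $(\kappa\otimes\mathbb P)$-integrable process $Q$ with $\mathbb Q[A]=\int_A Q\,d(\kappa\otimes\mathbb P)$ for all $A\in\mathcal O$. Moreover there are constants $\lambda^i>0$, $i=1,\dots,d$, such that each such density $Q$ satisfies $Q>0$ and $$c^i_t=\min\bigl(\Gamma^i_t,\;I^i(t,\lambda^iQ_t)\bigr),\qquad i=1,\dots,d,$$ $(\kappa\otimes\mathbb P)$-a.e. -/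

import Mathlib

open MeasureTheory Set Filter Topology
open scoped ENNReal

noncomputable section

namespace AbstractEquilibrium

/-! ### Time, the measure `κ`, the optional `σ`-algebra -/

/-- The time interval `[0,T]`. -/
abbrev Time (T : ℝ) : Type := Icc (0 : ℝ) T

/-- The initial time `0`. -/
def startTime {T : ℝ} (hT : 0 < T) : Time T := ⟨0, le_rfl, hT.le⟩

/-- The terminal time `T`. -/
def endTime {T : ℝ} (hT : 0 < T) : Time T := ⟨T, hT.le, le_rfl⟩

/-- The measure `κ` on `[0,T]`: `dκ_t = dt` on `[0,T)` and `κ({T}) = 1`. -/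
def kappa (T : ℝ) : Measure (Time T) :=
  ((volume : Measure ℝ).restrict (Ico 0 T) + Measure.dirac T).comap Subtype.val

/-- A path on `[0,T]` that is right-continuous with left limits. -/
def IsCadlag {T : ℝ} {E : Type*} [TopologicalSpace E] (x : Time T → E) : Prop :=
  ∀ t, ContinuousWithinAt x (Ioi t) t ∧ ∃ l, Tendsto x (𝓝[<] t) (𝓝 l)

/-- The standing requirements on the filtration: it is right-continuous and complete, `𝓕_0` is
trivial modulo `P`, and `𝓕_T` is the whole `σ`-algebra. -/
structure IsStandardFiltration {T : ℝ} (hT : 0 < T) {Ω : Type*} {mΩ : MeasurableSpace Ω}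
    (𝓕 : Filtration (Time T) mΩ) (P : Measure Ω) : Prop where
  rightContinuous : 𝓕.IsRightContinuous
  complete : ∀ N : Set Ω, P N = 0 → MeasurableSet[𝓕 (startTime hT)] N
  trivial_start : ∀ A : Set Ω, MeasurableSet[𝓕 (startTime hT)] A → P A = 0 ∨ P A = 1
  all_end : 𝓕 (endTime hT) = mΩ

/-- The optional `σ`-algebra on `[0,T] × Ω`: it is generated by the real-valued adapted processes
all of whose paths are right-continuous with left limits. -/
@[reducible] def optionalSigma {T : ℝ} {Ω : Type*} {mΩ : MeasurableSpace Ω} (𝓕 : Filtration (Time T) mΩ) :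
    MeasurableSpace (Time T × Ω) :=
  ⨆ X : {X : Time T → Ω → ℝ // Adapted 𝓕 X ∧ ∀ ω, IsCadlag fun t => X t ω},
    MeasurableSpace.comap (Function.uncurry X.1) inferInstance

/-- Optional sets are measurable for the product `σ`-algebra. -/
theorem optionalSigma_le {T : ℝ} {Ω : Type*} {mΩ : MeasurableSpace Ω} (𝓕 : Filtration (Time T) mΩ) :
    optionalSigma 𝓕 ≤ (inferInstance : MeasurableSpace (Time T × Ω)) := by
  refine iSup_le ?_
  rintro ⟨X, hX, hc⟩
  rw [← measurable_iff_comap_le]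
  by_cases hT : 0 ≤ T
  swap
  · have : IsEmpty (Time T) := ⟨fun t => hT (t.2.1.trans t.2.2)⟩
    exact measurable_of_empty _
  let g : ℕ → ℕ × Ω → ℝ := fun n q => X (projIcc 0 T hT (((q.1 : ℝ) + 1) / (n + 1))) q.2
  have hg : ∀ n, Measurable (g n) := fun n =>
    measurable_from_prod_countable_right fun k =>
      (hX (projIcc 0 T hT (((k : ℝ) + 1) / (n + 1)))).mono (𝓕.le _) le_rfl
  let φ : ℕ → Time T × Ω → ℕ × Ω := fun n p => (⌊(n + 1 : ℝ) * (p.1 : ℝ)⌋₊, p.2)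
  have hφ : ∀ n, Measurable (φ n) := fun n =>
    (Nat.measurable_floor.comp
      ((measurable_subtype_coe.comp measurable_fst).const_mul _)).prodMk measurable_snd
  refine measurable_of_tendsto_metrizable (fun n => (hg n).comp (hφ n)) ?_
  rw [tendsto_pi_nhds]
  rintro ⟨t, ω⟩
  have hcont : Tendsto (fun s => X s ω) (𝓝[≥] t) (𝓝 (X t ω)) :=
    continuousWithinAt_Ioi_iff_Ici.1 (hc ω t).1
  refine hcont.comp (tendsto_nhdsWithin_iff.2 ⟨?_, Eventually.of_forall fun n => ?_⟩)
  · have h1 : Tendsto (fun n : ℕ => ((⌊(n + 1 : ℝ) * (t : ℝ)⌋₊ : ℝ) + 1) / (n + 1)) atTop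
        (𝓝 (t : ℝ)) := by
      have h2 : Tendsto (fun n : ℕ => (t : ℝ) + 1 / ((n : ℝ) + 1)) atTop (𝓝 ((t : ℝ) + 0)) :=
        tendsto_const_nhds.add tendsto_one_div_add_atTop_nhds_zero_nat
      rw [add_zero] at h2
      refine tendsto_of_tendsto_of_tendsto_of_le_of_le tendsto_const_nhds h2 (fun n => ?_)
        (fun n => ?_)
      · have hn : (0 : ℝ) < n + 1 := by positivity
        change (t : ℝ) ≤ _
        rw [le_div_iff₀ hn, mul_comm]
        exact (Nat.lt_floor_add_one _).le
      · have hn : (0 : ℝ) < n + 1 := by positivity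
        change _ ≤ (t : ℝ) + 1 / ((n : ℝ) + 1)
        rw [add_div]
        gcongr
        rw [div_le_iff₀ hn, mul_comm]
        exact Nat.floor_le (mul_nonneg t.2.1 hn.le)
    have h3 := (continuous_projIcc (h := hT)).continuousAt.tendsto.comp h1
    rw [projIcc_val] at h3
    exact h3
  · have hn : (0 : ℝ) < n + 1 := by positivity
    change t ≤ projIcc 0 T hT (((⌊(n + 1 : ℝ) * (t : ℝ)⌋₊ : ℝ) + 1) / (n + 1))
    conv_lhs => rw [← projIcc_val hT t]
    apply monotone_projIcc
    rw [le_div_iff₀ hn, mul_comm]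
    exact (Nat.lt_floor_add_one _).le

/-- The measure `κ ⊗ P` on the optional `σ`-algebra. -/
def kappaP {T : ℝ} {Ω : Type*} {mΩ : MeasurableSpace Ω} (𝓕 : Filtration (Time T) mΩ)
    (P : Measure Ω) : @Measure (Time T × Ω) (optionalSigma 𝓕) :=
  ((kappa T).prod P).trim (optionalSigma_le 𝓕)

/-- The consumption space `L^∞` of (classes of) essentially bounded optional processes. -/
abbrev Linf {T : ℝ} {Ω : Type*} {mΩ : MeasurableSpace Ω} (𝓕 : Filtration (Time T) mΩ)
    (P : Measure Ω) : Type _ :=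
  Lp ℝ ∞ (kappaP 𝓕 P)

open Classical in
/-- The class in `L^∞` of an essentially bounded optional function (and `0` for others). -/
def toLinf {T : ℝ} {Ω : Type*} {mΩ : MeasurableSpace Ω} (𝓕 : Filtration (Time T) mΩ)
    (P : Measure Ω) (f : Time T × Ω → ℝ) : Linf 𝓕 P :=
  if h : MemLp f ∞ (kappaP 𝓕 P) then h.toLp f else 0

/-! ### Finitely-additive probabilities -/

/-- A finitely-additive probability on the optional `σ`-algebra that vanishes on `κ ⊗ P`-null sets,
seen as an element of the topological dual of `L^∞`: a positive functional of total mass one. -/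
structure IsFinAddProb {T : ℝ} {Ω : Type*} {mΩ : MeasurableSpace Ω}
    {𝓕 : Filtration (Time T) mΩ} {P : Measure Ω} (q : StrongDual ℝ (Linf 𝓕 P)) : Prop where
  nonneg : ∀ f : Linf 𝓕 P, (∀ᵐ p ∂(kappaP 𝓕 P), 0 ≤ f p) → 0 ≤ q f
  total : q (toLinf 𝓕 P fun _ => 1) = 1

/-- `Q` is an optional version of the Radon-Nikodym derivative of `q` with respect to `κ ⊗ P`:
it is optional and integrable, and `q(A) = ∫_A Q d(κ ⊗ P)` for each optional set `A`. -/
structure IsOptionalDensity {T : ℝ} {Ω : Type*} {mΩ : MeasurableSpace Ω}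
    {𝓕 : Filtration (Time T) mΩ} {P : Measure Ω} (q : StrongDual ℝ (Linf 𝓕 P))
    (Q : Time T × Ω → ℝ) : Prop where
  optional : Measurable[optionalSigma 𝓕] Q
  integrable : Integrable Q (kappaP 𝓕 P)
  density : ∀ A : Set (Time T × Ω), MeasurableSet[optionalSigma 𝓕] A →
    q (toLinf 𝓕 P (A.indicator fun _ => 1)) = ∫ p in A, Q p ∂(kappaP 𝓕 P)

/-! ### Endowments and withdrawal caps -/

/-- `e` is optional with `ε ≤ e ≤ 1/ε` for some `ε > 0`. -/
structure IsEndowment {T : ℝ} {Ω : Type*} {mΩ : MeasurableSpace Ω}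
    (𝓕 : Filtration (Time T) mΩ) (P : Measure Ω) (e : Time T → Ω → ℝ) : Prop where
  optional : Measurable[optionalSigma 𝓕] (Function.uncurry e)
  bounds : ∃ ε : ℝ, 0 < ε ∧ ∀ᵐ p ∂(kappaP 𝓕 P), ε ≤ e p.1 p.2 ∧ e p.1 p.2 ≤ 1 / ε

/-- `Γ` is an adapted `(0,∞]`-valued process with right-continuous paths with left limits,
`Γ > e`, and `Γ_T = ∞` almost surely. -/
structure IsWithdrawalCap {T : ℝ} (hT : 0 < T) {Ω : Type*} {mΩ : MeasurableSpace Ω}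
    (𝓕 : Filtration (Time T) mΩ) (P : Measure Ω) (e : Time T → Ω → ℝ)
    (Γ : Time T → Ω → ℝ≥0∞) : Prop where
  adapted : Adapted 𝓕 Γ
  cadlag : ∀ ω, IsCadlag fun t => Γ t ω
  pos : ∀ t ω, 0 < Γ t ω
  gt_endowment : ∀ᵐ p ∂(kappaP 𝓕 P), ENNReal.ofReal (e p.1 p.2) < Γ p.1 p.2
  terminal : ∀ᵐ ω ∂P, Γ (endTime hT) ω = ∞

/-! ### Utilities -/

/-- The total convexity norm `|f(x₁)| + |f'(x₁)| + TV(f'; [x₁,x₂])` on `[x₁,x₂]`. -/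
def convexityNorm (f : ℝ → ℝ) (x₁ x₂ : ℝ) : ℝ≥0∞ :=
  ENNReal.ofReal |f x₁| + ENNReal.ofReal |derivWithin f (Icc x₁ x₂) x₁| +
    eVariationOn (derivWithin f (Icc x₁ x₂)) (Icc x₁ x₂)

/-- `f`, continuously differentiable in the second variable, is convexity-Lipschitz on
`[0,T] × [x₁,x₂]`. -/
def ConvexityLipschitz {T : ℝ} (f : Time T → ℝ → ℝ) (x₁ x₂ : ℝ) : Prop :=
  (∀ t, ContDiffOn ℝ 1 (f t) (Icc x₁ x₂)) ∧
    ∃ C : ℝ, ∀ t s : Time T,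
      convexityNorm (fun x => f t x - f s x) x₁ x₂ ≤ ENNReal.ofReal (C * |(t : ℝ) - s|)

/-- `f : [0,T] × J → ℝ` is convexity-Lipschitz on `[0,T] × [x₁,x₂]` for each compact interval
`[x₁,x₂]` in `J`. -/
def LocallyConvexityLipschitz {T : ℝ} (f : Time T → ℝ → ℝ) (J : Set ℝ) : Prop :=
  ∀ x₁ x₂ : ℝ, x₁ < x₂ → Icc x₁ x₂ ⊆ J → ConvexityLipschitz f x₁ x₂

/-- The inverse marginal utility `I(t,·)`, the inverse of `U_x(t,·)` on `(0,∞)`. -/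
def invMarginal {T : ℝ} (U : Time T → ℝ → ℝ) (t : Time T) (y : ℝ) : ℝ :=
  Function.invFunOn (deriv (U t)) (Ioi 0) y

/-- The regularity required of a utility function `U : [0,T] × (0,∞) → ℝ` (only the values of
`U t x` with `x > 0` matter). The field `marginal_surj` says that `U_x(t,·)` attains every value
in `(0,∞)`, that is, that `I(t,·)` is defined on all of `(0,∞)`. -/
structure IsRegularUtility {T : ℝ} (U : Time T → ℝ → ℝ) : Prop where
  measurable : ∀ x, 0 < x → Measurable fun t => U t x
  strictConcave : ∀ t, StrictConcaveOn ℝ (Ioi 0) (U t)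
  contDiff : ∀ t, ContDiffOn ℝ 1 (U t) (Ioi 0)
  strictMono : ∀ t, StrictMonoOn (U t) (Ioi 0)
  bounded : ∀ x, 0 < x → ∃ K : ℝ, ∀ t, |U t x| ≤ K
  marginal_surj : ∀ t, SurjOn (deriv (U t)) (Ioi 0) (Ioi 0)
  inv_lipschitz : LocallyConvexityLipschitz (invMarginal U) (Ioi 0)
  inada_top : TendstoUniformly (fun y t => invMarginal U t y) (fun _ => 0) atTop
  inada_zero : ∀ K : ℝ, ∀ᶠ y in 𝓝[>] (0 : ℝ), ∀ t, K ≤ invMarginal U t y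

/-- The instantaneous utility on `[0,∞)`: the value at `0` is the limit of `U(t,y)` as `y ↓ 0`,
that is, the infimum (possibly `-∞`). -/
def instantUtility {T : ℝ} (U : Time T → ℝ → ℝ) (t : Time T) (x : ℝ) : EReal :=
  if 0 < x then (U t x : EReal) else ⨅ y ∈ Ioi (0 : ℝ), (U t y : EReal)

/-- The utility functional `E ∫ U(t, c_t) dκ_t`, set to `-∞` if the negative part has an infinite
integral. -/
def utilityFunctional {T : ℝ} {Ω : Type*} {mΩ : MeasurableSpace Ω}
    (𝓕 : Filtration (Time T) mΩ) (P : Measure Ω) (U : Time T → ℝ → ℝ)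
    (c : Time T × Ω → ℝ) : EReal :=
  if ∫⁻ p, (-instantUtility U p.1 (c p)).toENNReal ∂(kappaP 𝓕 P) = ∞ then ⊥
  else ((∫⁻ p, (instantUtility U p.1 (c p)).toENNReal ∂(kappaP 𝓕 P) : ℝ≥0∞) : EReal) -
    ((∫⁻ p, (-instantUtility U p.1 (c p)).toENNReal ∂(kappaP 𝓕 P) : ℝ≥0∞) : EReal)

/-! ### Abstract equilibria -/

/-- The bounded consumption processes that satisfy the withdrawal constraint `0 ≤ c ≤ Γ`. -/
def admissibleSet {T : ℝ} {Ω : Type*} {mΩ : MeasurableSpace Ω}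
    (𝓕 : Filtration (Time T) mΩ) (P : Measure Ω) (Γ : Time T → Ω → ℝ≥0∞) : Set (Linf 𝓕 P) :=
  {c | ∀ᵐ p ∂(kappaP 𝓕 P), 0 ≤ c p ∧ ENNReal.ofReal (c p) ≤ Γ p.1 p.2}

/-- The budget set: the admissible `c` with `⟨q, c⟩ ≤ ⟨q, e⟩`. -/
def budgetSet {T : ℝ} {Ω : Type*} {mΩ : MeasurableSpace Ω}
    {𝓕 : Filtration (Time T) mΩ} {P : Measure Ω} (q : StrongDual ℝ (Linf 𝓕 P))
    (e : Time T → Ω → ℝ) (Γ : Time T → Ω → ℝ≥0∞) : Set (Linf 𝓕 P) :=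
  {c | c ∈ admissibleSet 𝓕 P Γ ∧ q c ≤ q (toLinf 𝓕 P (Function.uncurry e))}

/-- `(q, (cⁱ))` is an abstract equilibrium: `q` is a finitely-additive probability, the market
clears, and each `cⁱ` maximizes the utility functional of agent `i` over the budget set. -/
structure IsAbstractEquilibrium {T : ℝ} {Ω : Type*} {mΩ : MeasurableSpace Ω}
    {𝓕 : Filtration (Time T) mΩ} {P : Measure Ω} {d : ℕ}
    (e : Fin d → Time T → Ω → ℝ) (Γ : Fin d → Time T → Ω → ℝ≥0∞)
    (U : Fin d → Time T → ℝ → ℝ)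
    (q : StrongDual ℝ (Linf 𝓕 P)) (c : Fin d → Linf 𝓕 P) : Prop where
  probability : IsFinAddProb q
  clearing : ∑ i, c i = ∑ i, toLinf 𝓕 P (Function.uncurry (e i))
  budget : ∀ i, c i ∈ budgetSet q (e i) (Γ i)
  optimal : ∀ i, ∀ x ∈ budgetSet q (e i) (Γ i),
    utilityFunctional 𝓕 P (U i) x ≤ utilityFunctional 𝓕 P (U i) (c i)

end AbstractEquilibrium

end

open AbstractEquilibrium

/-! The density exists because `q` cannot put substantial mass on small sets. If an agent's
consumption on a set `A` of small measure were expensive, the agent could cut it there to a small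
level `η` and spend the savings on `η` extra units wherever the cap is infinite. Time `T` is an atom
of `κ` with infinite cap, so this region has positive measure and the gain is a fixed positive
number, while the loss is at most a constant times the measure of `A`: a contradiction with
optimality (`exists_cost_le`). Summing over agents, market clearing and endowments bounded below
turn small costs into small `q(A)`. This makes `q` countably additive, and Radon-Nikodym applies
(`exists_density`, `exists_isPriceDensity`).

Where `Q ≤ 0`, an agent below the cap could consume more at no cost, so every agent would be capped
and would consume more than the endowment, which contradicts clearing (`ae_density_pos`,
`IsPriceDensity.ae_pos`).

The formula for consumption is a first-order condition. A budget-neutral transfer between two sets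
cannot raise utility (`measure_eq_zero_or`). Hence one constant `lam` separates the ratios of
marginal utility to price: the ratio is at most `lam` where the cap is slack and at least `lam`
where consumption is positive (`exists_multiplier`). Inverting the marginal utility gives the
formula. The analysis takes place on a finite measure space `X` with a time map `τ`, later
specialized to the optional `σ`-algebra. -/

namespace AbstractEquilibrium

/-! ### The instantaneous utility -/

section InstantUtility

variable {T : ℝ} {U : Time T → ℝ → ℝ}

theorem instantUtility_of_pos (t : Time T) {x : ℝ} (hx : 0 < x) :
    instantUtility U t x = (U t x : EReal) :=
  if_pos hx

theorem instantUtility_of_nonpos (t : Time T) {x : ℝ} (hx : x ≤ 0) :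
    instantUtility U t x = ⨅ y ∈ Ioi (0 : ℝ), (U t y : EReal) :=
  if_neg hx.not_gt

theorem instantUtility_zero_le (t : Time T) {y : ℝ} (hy : 0 < y) :
    instantUtility U t 0 ≤ (U t y : EReal) := by
  rw [instantUtility_of_nonpos t le_rfl]
  exact iInf₂_le y hy

theorem instantUtility_ne_top (t : Time T) (x : ℝ) : instantUtility U t x ≠ ⊤ := by
  rcases le_or_gt x 0 with hx | hx
  · rw [instantUtility_of_nonpos t hx]
    exact ne_top_of_le_ne_top (EReal.coe_ne_top (U t 1)) (iInf₂_le 1 one_pos)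
  · rw [instantUtility_of_pos t hx]
    exact EReal.coe_ne_top _

namespace IsRegularUtility

theorem instantUtility_mono (hU : IsRegularUtility U) (t : Time T) :
    Monotone (instantUtility U t) := by
  intro x y hxy
  rcases le_or_gt y 0 with hy | hy
  · rw [instantUtility_of_nonpos t hy, instantUtility_of_nonpos t (hxy.trans hy)]
  rw [instantUtility_of_pos t hy]
  rcases le_or_gt x 0 with hx | hx
  · rw [instantUtility_of_nonpos t hx]
    exact iInf₂_le y hy
  · rw [instantUtility_of_pos t hx, EReal.coe_le_coe_iff]
    exact (hU.strictMono t).monotoneOn hx hy hxy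

theorem instantUtility_lt (hU : IsRegularUtility U) (t : Time T) {x y : ℝ} (hx : 0 ≤ x)
    (hxy : x < y) : instantUtility U t x < instantUtility U t y := by
  have hm : 0 < (x + y) / 2 := by linarith
  calc instantUtility U t x ≤ instantUtility U t ((x + y) / 2) :=
        hU.instantUtility_mono t (by linarith)
    _ < instantUtility U t y := by
        rw [instantUtility_of_pos t hm, instantUtility_of_pos t (by linarith),
          EReal.coe_lt_coe_iff]
        exact hU.strictMono t hm (by simp only [mem_Ioi]; linarith) (by linarith)

/-- Concavity on `[0,∞)`: an average increase of at least `k` persists on shorter intervals. -/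
theorem instantUtility_add_le (hU : IsRegularUtility U) (t : Time T) {x k ε δ : ℝ} (hx : 0 ≤ x)
    (hε : 0 < ε) (hεδ : ε ≤ δ)
    (h : instantUtility U t x + ((k * δ : ℝ) : EReal) ≤ instantUtility U t (x + δ)) :
    instantUtility U t x + ((k * ε : ℝ) : EReal) ≤ instantUtility U t (x + ε) := by
  rcases hεδ.eq_or_lt with rfl | hεδ
  · exact h
  induction hl : instantUtility U t x with
  | bot => simp
  | top => exact absurd hl (instantUtility_ne_top t x)
  | coe l =>
    rw [hl, instantUtility_of_pos t (by linarith), ← EReal.coe_add, EReal.coe_le_coe_iff] at h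
    rw [instantUtility_of_pos t (by linarith), ← EReal.coe_add, EReal.coe_le_coe_iff]
    have hd : 0 < δ - ε := by linarith
    -- Concavity is known only on `(0,∞)` and `x` may be `0`. So `x + ε` is written as a convex
    -- combination of `x + δ` and a point `y > x`, whose utility is at least `l`; then `y` tends to
    -- `x`.
    have key : ∀ y ∈ Ioo x (x + ε),
        ((δ - ε) * l + (x + ε - y) * U t (x + δ)) / (x + δ - y) ≤ U t (x + ε) := by
      intro y hy
      have hy0 : 0 < y := hx.trans_lt hy.1
      have hly : l ≤ U t y := by
        have := hU.instantUtility_mono t hy.1.le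
        rwa [hl, instantUtility_of_pos t hy0, EReal.coe_le_coe_iff] at this
      have h1 : 0 < x + δ - y := by linarith [hy.2]
      have h2 : 0 < x + ε - y := by linarith [hy.2]
      have hc := (hU.strictConcave t).concaveOn.2 (show y ∈ Ioi 0 from hy0)
        (show x + δ ∈ Ioi (0 : ℝ) by simp only [mem_Ioi]; linarith)
        (div_pos hd h1).le (div_pos h2 h1).le
        (by rw [← add_div, div_eq_one_iff_eq h1.ne']; ring)
      simp only [smul_eq_mul] at hc
      have he : (δ - ε) / (x + δ - y) * y + (x + ε - y) / (x + δ - y) * (x + δ) = x + ε := by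
        field_simp; ring
      rw [he] at hc
      refine le_trans ?_ hc
      rw [add_div, mul_div_right_comm, mul_div_right_comm]
      gcongr
    have hlim : Tendsto (fun y => ((δ - ε) * l + (x + ε - y) * U t (x + δ)) / (x + δ - y))
        (𝓝[>] x) (𝓝 (((δ - ε) * l + (x + ε - x) * U t (x + δ)) / (x + δ - x))) := by
      refine Tendsto.mono_left (ContinuousAt.tendsto ?_) nhdsWithin_le_nhds
      refine ContinuousAt.div (by fun_prop) (by fun_prop) ?_
      have : x + δ - x = δ := by ring
      rw [this]
      linarith
    have hle := le_of_tendsto hlim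
      (eventually_of_mem (Ioo_mem_nhdsGT (by linarith : x < x + ε)) key)
    refine le_trans ?_ hle
    rw [le_div_iff₀ (by linarith)]
    nlinarith

/-- Concavity: an average decrease of at most `k` persists on shorter intervals. -/
theorem le_sub_add (hU : IsRegularUtility U) (t : Time T) {x k ε δ : ℝ} (hδ : δ < x)
    (hε : 0 < ε) (hεδ : ε ≤ δ) (h : U t x ≤ U t (x - δ) + k * δ) :
    U t x ≤ U t (x - ε) + k * ε := by
  have hδ0 : 0 < δ := hε.trans_le hεδ
  have hc := (hU.strictConcave t).concaveOn.2 (show x ∈ Ioi (0 : ℝ) from hδ0.trans hδ)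
    (show x - δ ∈ Ioi (0 : ℝ) by simp only [mem_Ioi]; linarith)
    (sub_nonneg.2 ((div_le_one hδ0).2 hεδ)) (div_pos hε hδ0).le (by ring)
  simp only [smul_eq_mul] at hc
  have he : (1 - ε / δ) * x + ε / δ * (x - δ) = x - ε := by field_simp; ring
  rw [he] at hc
  have h2 : ε / δ * U t x ≤ ε / δ * (U t (x - δ) + k * δ) := by gcongr
  have h3 : ε / δ * (k * δ) = k * ε := by field_simp
  nlinarith

theorem differentiableAt (hU : IsRegularUtility U) (t : Time T) {x : ℝ} (hx : 0 < x) :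
    DifferentiableAt ℝ (U t) x :=
  ((hU.contDiff t).differentiableOn one_ne_zero).differentiableAt (Ioi_mem_nhds hx)

theorem strictAntiOn_deriv (hU : IsRegularUtility U) (t : Time T) :
    StrictAntiOn (deriv (U t)) (Ioi 0) :=
  (hU.strictConcave t).strictAntiOn_deriv fun _ hx => hU.differentiableAt t hx

theorem invMarginal_deriv (hU : IsRegularUtility U) (t : Time T) {x : ℝ} (hx : 0 < x) :
    invMarginal U t (deriv (U t) x) = x :=
  (hU.strictAntiOn_deriv t).injOn.leftInvOn_invFunOn hx

theorem invMarginal_pos (hU : IsRegularUtility U) (t : Time T) {y : ℝ} (hy : 0 < y) :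
    0 < invMarginal U t y :=
  Function.invFunOn_mem (hU.marginal_surj t hy)

theorem deriv_invMarginal (hU : IsRegularUtility U) (t : Time T) {y : ℝ} (hy : 0 < y) :
    deriv (U t) (invMarginal U t y) = y :=
  Function.invFunOn_eq (hU.marginal_surj t hy)

theorem tendsto_slope (hU : IsRegularUtility U) (t : Time T) {x : ℝ} (hx : 0 < x) (s : ℝ)
    (hs : s ≠ 0) :
    Tendsto (fun n : ℕ => (s * (1 / ((n : ℝ) + 1)))⁻¹ *
      (U t (x + s * (1 / ((n : ℝ) + 1))) - U t x)) atTop (𝓝 (deriv (U t) x)) := by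
  have h := hasDerivAt_iff_tendsto_slope_zero.1 (hU.differentiableAt t hx).hasDerivAt
  simp only [smul_eq_mul] at h
  refine h.comp (tendsto_nhdsWithin_iff.2 ⟨?_, Eventually.of_forall fun n => ?_⟩)
  · simpa using tendsto_one_div_add_atTop_nhds_zero_nat.const_mul s
  · simp only [mem_compl_iff, mem_singleton_iff]
    positivity

theorem deriv_le_of_forall_add_le (hU : IsRegularUtility U) (t : Time T) {x b : ℝ} (hx : 0 < x)
    (h : ∀ᶠ n : ℕ in atTop, U t (x + 1 / (n + 1)) ≤ U t x + b * (1 / (n + 1))) :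
    deriv (U t) x ≤ b := by
  refine le_of_tendsto (hU.tendsto_slope t hx 1 one_ne_zero) (h.mono fun n hn => ?_)
  have : (0 : ℝ) < 1 / (n + 1) := by positivity
  rw [one_mul, inv_mul_le_iff₀ this]
  linarith

theorem le_deriv_of_forall_le_sub (hU : IsRegularUtility U) (t : Time T) {x a : ℝ} (hx : 0 < x)
    (h : ∀ᶠ n : ℕ in atTop, U t (x - 1 / (n + 1)) + a * (1 / (n + 1)) ≤ U t x) :
    a ≤ deriv (U t) x := by
  refine ge_of_tendsto (hU.tendsto_slope t hx (-1) (by norm_num)) (h.mono fun n hn => ?_)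
  have : (0 : ℝ) < 1 / (n + 1) := by positivity
  rw [neg_one_mul, inv_neg, neg_mul, ← mul_neg, le_inv_mul_iff₀ this, ← sub_eq_add_neg]
  linarith

/-- The marginal utility at zero is infinite. -/
theorem eventually_instantUtility_zero_add_lt (hU : IsRegularUtility U) (t : Time T) (k : ℝ) :
    ∀ᶠ n : ℕ in atTop, instantUtility U t 0 + ((k * (1 / ((n : ℝ) + 1)) : ℝ) : EReal) <
      instantUtility U t (1 / ((n : ℝ) + 1)) := by
  obtain ⟨x, hx, hxk⟩ := hU.marginal_surj t (show |k| + 1 ∈ Ioi (0 : ℝ) from by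
    simp only [mem_Ioi]; positivity)
  filter_upwards [tendsto_one_div_add_atTop_nhds_zero_nat.eventually_lt_const
    (mem_Ioi.1 hx)] with n hn
  set δ : ℝ := 1 / ((n : ℝ) + 1) with hδd
  have hδ : 0 < δ := by positivity
  rw [instantUtility_of_pos t hδ]
  -- The slope on `[y, δ]` is at least `|k| + 1`, and this `y` makes the omitted part `(|k| + 1) *
  -- y` equal to `δ / 2`, so the increase still exceeds `k * δ`.
  set y : ℝ := δ / (2 * (|k| + 1)) with hyd
  have hk : 0 ≤ |k| := abs_nonneg k
  have hy : 0 < y := by positivity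
  have hyk : y * (2 * (|k| + 1)) = δ := by rw [hyd]; field_simp
  have hyδ : y < δ := by nlinarith
  have h1 : |k| + 1 ≤ deriv (U t) δ := by
    rw [← hxk]; exact ((hU.strictAntiOn_deriv t).antitoneOn) hδ hx hn.le
  have h2 := (hU.strictConcave t).concaveOn.deriv_le_slope hy hδ hyδ (hU.differentiableAt t hδ)
  rw [slope_def_field, le_div_iff₀ (by linarith)] at h2
  refine lt_of_le_of_lt (add_le_add_left (instantUtility_zero_le t hy) _) ?_
  rw [← EReal.coe_add, EReal.coe_lt_coe_iff]
  nlinarith [le_abs_self k, mul_le_mul_of_nonneg_right h1 (by linarith : 0 ≤ δ - y),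
    mul_le_mul_of_nonneg_right (le_abs_self k) hδ.le]

/-- Serves measurability, including the possible value `-∞` at `0`. Through `exp` and `log` the
utility becomes a function on the whole line, continuous in one variable and measurable in time,
hence jointly measurable. -/
theorem instantUtility_eq_iInf (hU : IsRegularUtility U) (t : Time T) (x : ℝ) :
    instantUtility U t x =
      ⨅ n : ℕ, ((U t (Real.exp (Real.log (max x 0 + 1 / ((n : ℝ) + 1)))) : ℝ) : EReal) := by
  have hpos : ∀ n : ℕ, 0 < max x 0 + 1 / ((n : ℝ) + 1) := fun n => by positivity
  simp only [Real.exp_log (hpos _)]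
  refine le_antisymm (le_iInf fun n => ?_) ?_
  · rw [← instantUtility_of_pos t (hpos n)]
    refine hU.instantUtility_mono t ?_
    have : (0 : ℝ) < 1 / ((n : ℝ) + 1) := by positivity
    linarith [le_max_left x 0]
  · rcases le_or_gt x 0 with hx | hx
    · rw [instantUtility_of_nonpos t hx]
      refine le_iInf₂ fun y hy => ?_
      obtain ⟨n, hn⟩ :=
        (tendsto_one_div_add_atTop_nhds_zero_nat.eventually_lt_const (mem_Ioi.1 hy)).exists
      refine (iInf_le _ n).trans ?_
      rw [EReal.coe_le_coe_iff, max_eq_right hx, zero_add]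
      exact (hU.strictMono t).monotoneOn (by simp only [mem_Ioi]; positivity) hy hn.le
    · rw [instantUtility_of_pos t hx]
      have hlim : Tendsto (fun n : ℕ => ((U t (max x 0 + 1 / ((n : ℝ) + 1)) : ℝ) : EReal)) atTop
          (𝓝 (U t x : EReal)) := by
        refine (continuous_coe_real_ereal.tendsto _).comp
          ((hU.differentiableAt t hx).continuousAt.tendsto.comp ?_)
        rw [max_eq_left hx.le]
        simpa using tendsto_one_div_add_atTop_nhds_zero_nat.const_add x
      exact ge_of_tendsto' hlim fun n => iInf_le _ n

theorem measurable_instantUtility (hU : IsRegularUtility U) {X : Type*} {mX : MeasurableSpace X}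
    {τ : X → Time T} (hτ : Measurable τ) {f : X → ℝ} (hf : Measurable f) :
    Measurable fun p => instantUtility U (τ p) (f p) := by
  have h1 : Measurable (Function.uncurry fun (s : ℝ) (t : Time T) => U t (Real.exp s)) := by
    refine measurable_uncurry_of_continuous_of_measurable (fun t => ?_)
      fun s => hU.measurable _ (Real.exp_pos s)
    exact continuous_iff_continuousAt.2 fun s => ContinuousAt.comp'
      (hU.differentiableAt t (Real.exp_pos s)).continuousAt Real.continuous_exp.continuousAt
  simp only [hU.instantUtility_eq_iInf]
  refine Measurable.iInf fun n => measurable_coe_real_ereal.comp ?_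
  exact h1.comp ((Real.measurable_log.comp ((hf.max measurable_const).add_const _)).prodMk hτ)

theorem exists_instantUtility_le (hU : IsRegularUtility U) (M : ℝ) :
    ∃ K : ℝ, ∀ t, ∀ x ≤ M, instantUtility U t x ≤ (K : EReal) := by
  obtain ⟨K, hK⟩ := hU.bounded (max M 1) (by positivity)
  refine ⟨K, fun t x hx => (hU.instantUtility_mono t (hx.trans (le_max_left M 1))).trans ?_⟩
  rw [instantUtility_of_pos t (by positivity), EReal.coe_le_coe_iff]
  exact (le_abs_self _).trans (hK t)

theorem exists_le_instantUtility (hU : IsRegularUtility U) {η : ℝ} (hη : 0 < η) :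
    ∃ K : ℝ, ∀ t, ∀ x, η ≤ x → (K : EReal) ≤ instantUtility U t x := by
  obtain ⟨K, hK⟩ := hU.bounded η hη
  refine ⟨-K, fun t x hx => le_trans ?_ (hU.instantUtility_mono t hx)⟩
  rw [instantUtility_of_pos t hη, EReal.coe_le_coe_iff]
  exact neg_le_of_abs_le (hK t)

end IsRegularUtility

end InstantUtility

/-! ### Positive functionals on `L^∞` -/

section Functional

variable {X : Type*} {mX : MeasurableSpace X} {μ : Measure X}

open Classical in
/-- The class in `L^∞(μ)` of an essentially bounded function (and `0` for others). -/
noncomputable def boundedClass (μ : Measure X) (f : X → ℝ) : Lp ℝ ∞ μ :=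
  if h : MemLp f ∞ μ then h.toLp f else 0

theorem boundedClass_ae_eq {f : X → ℝ} (hf : MemLp f ∞ μ) : boundedClass μ f =ᵐ[μ] f := by
  rw [boundedClass, dif_pos hf]
  exact hf.coeFn_toLp

theorem memLp_indicator_one [IsFiniteMeasure μ] {A : Set X} (hA : MeasurableSet A) :
    MemLp (A.indicator fun _ => (1 : ℝ)) ∞ μ :=
  (memLp_const 1).indicator hA

theorem boundedClass_indicator_ae_eq [IsFiniteMeasure μ] {A : Set X} (hA : MeasurableSet A) :
    boundedClass μ (A.indicator fun _ => (1 : ℝ)) =ᵐ[μ] A.indicator fun _ => (1 : ℝ) :=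
  boundedClass_ae_eq (memLp_indicator_one hA)

theorem exists_ae_le (f : Lp ℝ ∞ μ) : ∃ M : ℝ, ∀ᵐ p ∂μ, f p ≤ M := by
  have h := Lp.memLp f
  refine ⟨(eLpNorm f ∞ μ).toReal, ?_⟩
  rw [eLpNorm_exponent_top] at *
  filter_upwards [ae_le_eLpNormEssSup (f := f) (μ := μ)] with p hp
  refine (le_abs_self _).trans ?_
  rw [← Real.norm_eq_abs, ← toReal_enorm]
  exact ENNReal.toReal_mono (by simpa [eLpNorm_exponent_top] using h.eLpNorm_ne_top) hp

/-- A positive functional on `L^∞` of total mass one. -/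
structure IsPositiveUnital (q : StrongDual ℝ (Lp ℝ ∞ μ)) : Prop where
  nonneg : ∀ f : Lp ℝ ∞ μ, (∀ᵐ p ∂μ, 0 ≤ f p) → 0 ≤ q f
  total : q (boundedClass μ fun _ => 1) = 1

/-- The finitely additive set function of a functional. -/
noncomputable def mass (q : StrongDual ℝ (Lp ℝ ∞ μ)) (A : Set X) : ℝ :=
  q (boundedClass μ (A.indicator fun _ => 1))

theorem mass_empty (q : StrongDual ℝ (Lp ℝ ∞ μ)) [IsFiniteMeasure μ] : mass q ∅ = 0 := by
  have : boundedClass μ ((∅ : Set X).indicator fun _ => (1 : ℝ)) = 0 := by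
    refine Lp.ext ?_
    filter_upwards [boundedClass_indicator_ae_eq (μ := μ) MeasurableSet.empty,
      Lp.coeFn_zero ℝ ∞ μ] with p h1 h2
    rw [h1, h2]
    simp
  rw [mass, this, map_zero]

theorem mass_union (q : StrongDual ℝ (Lp ℝ ∞ μ)) [IsFiniteMeasure μ] {A B : Set X}
    (hA : MeasurableSet A) (hB : MeasurableSet B) (hAB : Disjoint A B) :
    mass q (A ∪ B) = mass q A + mass q B := by
  rw [mass, mass, mass, ← map_add]
  congr 1
  refine Lp.ext ?_
  filter_upwards [boundedClass_indicator_ae_eq (μ := μ) hA,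
    boundedClass_indicator_ae_eq (μ := μ) hB,
    boundedClass_indicator_ae_eq (μ := μ) (hA.union hB),
    Lp.coeFn_add (boundedClass μ (A.indicator fun _ => (1 : ℝ)))
      (boundedClass μ (B.indicator fun _ => (1 : ℝ)))] with p h1 h2 h3 h4
  rw [h3, h4, Pi.add_apply, h1, h2, indicator_union_of_disjoint hAB]

namespace IsPositiveUnital

variable {q : StrongDual ℝ (Lp ℝ ∞ μ)}

theorem mono (hq : IsPositiveUnital q) {f g : Lp ℝ ∞ μ} (h : ∀ᵐ p ∂μ, f p ≤ g p) :
    q f ≤ q g := by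
  rw [← sub_nonneg, ← map_sub]
  refine hq.nonneg _ ?_
  filter_upwards [h, Lp.coeFn_sub g f] with p h1 h2
  rw [h2, Pi.sub_apply]
  linarith

variable [IsFiniteMeasure μ]

theorem mass_nonneg (hq : IsPositiveUnital q) {A : Set X} (hA : MeasurableSet A) :
    0 ≤ mass q A := by
  refine hq.nonneg _ ?_
  filter_upwards [boundedClass_indicator_ae_eq (μ := μ) hA] with p h
  rw [h]
  exact indicator_nonneg (fun _ _ => zero_le_one) _

theorem mass_le_one (hq : IsPositiveUnital q) {A : Set X} (hA : MeasurableSet A) :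
    mass q A ≤ 1 := by
  rw [← hq.total]
  refine hq.mono ?_
  filter_upwards [boundedClass_indicator_ae_eq (μ := μ) hA,
    boundedClass_ae_eq (μ := μ) (memLp_const (1 : ℝ))] with p h h'
  rw [h, h']
  exact indicator_le_self' (fun _ _ => zero_le_one) _

theorem mass_eq_zero (hq : IsPositiveUnital q) {A : Set X} (hA : MeasurableSet A)
    (h0 : μ A = 0) : mass q A = 0 := by
  refine le_antisymm ?_ (hq.mass_nonneg hA)
  rw [← map_zero q]
  refine hq.mono ?_
  filter_upwards [boundedClass_indicator_ae_eq (μ := μ) hA, Lp.coeFn_zero ℝ ∞ μ,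
    measure_eq_zero_iff_ae_notMem.1 h0] with p h1 h2 h3
  rw [h1, h2, indicator_of_notMem h3]
  rfl

/-- A functional whose set function is absolutely continuous has a density. -/
theorem exists_density (hq : IsPositiveUnital q)
    (hac : ∀ κ : ℝ, 0 < κ → ∃ ρ : ℝ≥0∞, 0 < ρ ∧
      ∀ A : Set X, MeasurableSet A → μ A < ρ → mass q A ≤ κ) :
    ∃ Q : X → ℝ, Measurable Q ∧ Integrable Q μ ∧
      ∀ A : Set X, MeasurableSet A → mass q A = ∫ p in A, Q p ∂μ := by
  have hsum : ∀ f : ℕ → Set X, (∀ n, MeasurableSet (f n)) → Pairwise (Function.onFun Disjoint f) →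
      ENNReal.ofReal (mass q (⋃ n, f n)) = ∑' n, ENNReal.ofReal (mass q (f n)) := by
    intro f hf hd
    let S : ℕ → Set X := fun n => ⋃ k ∈ Finset.range n, f k
    have hSm : ∀ n, MeasurableSet (S n) := fun n =>
      Finset.measurableSet_biUnion _ fun k _ => hf k
    have hUm : MeasurableSet (⋃ n, f n) := MeasurableSet.iUnion hf
    have hSs : ∀ n, mass q (S n) = ∑ k ∈ Finset.range n, mass q (f k) := by
      intro n
      induction n with
      | zero => simp [S, mass_empty]
      | succ n ih =>
        have h1 : S (n + 1) = S n ∪ f n := by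
          ext p
          simp only [S, Finset.mem_range, mem_iUnion, mem_union, exists_prop,
            Nat.lt_succ_iff_lt_or_eq]
          grind
        rw [h1, mass_union q (hSm n) (hf n), ih, Finset.sum_range_succ]
        refine disjoint_iUnion₂_left.2 fun k hk => hd (Finset.mem_range.1 hk).ne
    have hsplit : ∀ n, mass q (⋃ n, f n) = mass q (S n) + mass q ((⋃ n, f n) \ S n) := by
      intro n
      rw [← mass_union q (hSm n) (hUm.diff (hSm n)) disjoint_sdiff_right, union_sdiff_cancel]
      exact iUnion₂_subset fun k _ => subset_iUnion f k
    have htail : Tendsto (fun n => μ ((⋃ n, f n) \ S n)) atTop (𝓝 0) := by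
      have h := tendsto_measure_iInter_atTop (μ := μ) (s := fun n => (⋃ n, f n) \ S n)
        (fun n => (hUm.diff (hSm n)).nullMeasurableSet)
        (fun m n hmn => sdiff_subset_sdiff_right
          (biUnion_subset_biUnion_left fun k hk => by
            simp only [Finset.coe_range, mem_Iio] at hk ⊢
            omega))
        ⟨0, measure_ne_top _ _⟩
      have he : ⋂ n, (⋃ n, f n) \ S n = ∅ := by
        refine eq_empty_of_forall_notMem fun p hp => ?_
        rw [mem_iInter] at hp
        obtain ⟨k, hk⟩ := mem_iUnion.1 (hp 0).1
        exact (hp (k + 1)).2 (mem_biUnion (Finset.mem_coe.2 (Finset.mem_range.2 k.lt_succ_self)) hk)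
      rwa [he, measure_empty] at h
    -- Absolute continuity in the `ε`-`δ` sense enters here: it upgrades finite to countable
    -- additivity.
    have htail' : Tendsto (fun n => mass q ((⋃ n, f n) \ S n)) atTop (𝓝 0) := by
      rw [Metric.tendsto_atTop']
      intro ε hε
      obtain ⟨ρ, hρ, hρA⟩ := hac (ε / 2) (half_pos hε)
      obtain ⟨N, hN⟩ := eventually_atTop.1 (htail.eventually_lt_const hρ)
      refine ⟨N, fun n hn => ?_⟩
      have hm := hUm.diff (hSm n)
      rw [Real.dist_0_eq_abs, abs_of_nonneg (hq.mass_nonneg hm)]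
      exact (hρA _ hm (hN n hn.le)).trans_lt (half_lt_self hε)
    have hlim : Tendsto (fun n => ∑ k ∈ Finset.range n, mass q (f k)) atTop
        (𝓝 (mass q (⋃ n, f n))) := by
      have h := htail'.const_sub (mass q (⋃ n, f n))
      rw [sub_zero] at h
      refine h.congr fun n => ?_
      rw [← hSs, hsplit n]
      ring
    refine tendsto_nhds_unique (ENNReal.tendsto_ofReal hlim) ?_
    simp only [ENNReal.ofReal_sum_of_nonneg fun k _ => hq.mass_nonneg (hf k)]
    exact ENNReal.tendsto_nat_tsum _
  let ν : Measure X := Measure.ofMeasurable (fun A _ => ENNReal.ofReal (mass q A))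
    (by simp [mass_empty]) (fun f hf hd => hsum f hf hd)
  have hν : ∀ A, MeasurableSet A → ν A = ENNReal.ofReal (mass q A) := fun A hA =>
    Measure.ofMeasurable_apply A hA
  have hfin : IsFiniteMeasure ν := ⟨by rw [hν _ MeasurableSet.univ]; exact ENNReal.ofReal_lt_top⟩
  have hνμ : ν ≪ μ := by
    refine Measure.AbsolutelyContinuous.mk fun A hA h0 => ?_
    rw [hν A hA, hq.mass_eq_zero hA h0, ENNReal.ofReal_zero]
  refine ⟨fun p => (ν.rnDeriv μ p).toReal, (Measure.measurable_rnDeriv ν μ).ennreal_toReal,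
    Measure.integrable_toReal_rnDeriv, fun A hA => ?_⟩
  rw [Measure.setIntegral_toReal_rnDeriv hνμ, measureReal_def, hν A hA,
    ENNReal.toReal_ofReal (hq.mass_nonneg hA)]

end IsPositiveUnital

end Functional

/-! ### Expected utility and optimal choices -/

section Choice

variable {T : ℝ} {X : Type*} {mX : MeasurableSpace X} {μ : Measure X}

/-- The utility functional on an abstract measure space with a time coordinate `τ`. -/
noncomputable def expectedUtility (μ : Measure X) (τ : X → Time T) (U : Time T → ℝ → ℝ)
    (x : X → ℝ) : EReal :=
  if ∫⁻ p, (-instantUtility U (τ p) (x p)).toENNReal ∂μ = ∞ then ⊥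
  else ((∫⁻ p, (instantUtility U (τ p) (x p)).toENNReal ∂μ : ℝ≥0∞) : EReal) -
    ((∫⁻ p, (-instantUtility U (τ p) (x p)).toENNReal ∂μ : ℝ≥0∞) : EReal)

/-- If the negative part of the utility of a bounded `x` is integrable, then so is the utility, and
the utility functional is its integral. -/
theorem IsRegularUtility.expectedUtility_eq [IsFiniteMeasure μ] {U : Time T → ℝ → ℝ}
    (hU : IsRegularUtility U) {τ : X → Time T} (hτ : Measurable τ) {x : X → ℝ}
    (hx : Measurable x) {M : ℝ} (hM : ∀ᵐ p ∂μ, x p ≤ M)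
    (hneg : ∫⁻ p, (-instantUtility U (τ p) (x p)).toENNReal ∂μ ≠ ∞) :
    (∀ᵐ p ∂μ, instantUtility U (τ p) (x p) ≠ ⊥) ∧
    Integrable (fun p => (instantUtility U (τ p) (x p)).toReal) μ ∧
    expectedUtility μ τ U x =
      ((∫ p, (instantUtility U (τ p) (x p)).toReal ∂μ : ℝ) : EReal) := by
  have hm := hU.measurable_instantUtility hτ hx
  have hbot : ∀ᵐ p ∂μ, instantUtility U (τ p) (x p) ≠ ⊥ := by
    filter_upwards [ae_lt_top hm.neg.ereal_toENNReal hneg] with p hp hb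
    simp [hb] at hp
  have hcoe : ∀ᵐ p ∂μ, (((instantUtility U (τ p) (x p)).toReal : ℝ) : EReal) =
      instantUtility U (τ p) (x p) := by
    filter_upwards [hbot] with p hp
    exact EReal.coe_toReal (instantUtility_ne_top _ _) hp
  -- Bounded consumption has utility bounded above uniformly in time, so the positive part is
  -- integrable automatically.
  obtain ⟨K, hK⟩ := hU.exists_instantUtility_le M
  have hposE : ∫⁻ p, (instantUtility U (τ p) (x p)).toENNReal ∂μ =
      ∫⁻ p, ENNReal.ofReal (instantUtility U (τ p) (x p)).toReal ∂μ := by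
    refine lintegral_congr_ae ?_
    filter_upwards [hcoe] with p hp
    rw [← EReal.real_coe_toENNReal, hp]
  have hnegE : ∫⁻ p, (-instantUtility U (τ p) (x p)).toENNReal ∂μ =
      ∫⁻ p, ENNReal.ofReal (-(instantUtility U (τ p) (x p)).toReal) ∂μ := by
    refine lintegral_congr_ae ?_
    filter_upwards [hcoe] with p hp
    rw [← EReal.real_coe_toENNReal, EReal.coe_neg, hp]
  have hpos : ∫⁻ p, (instantUtility U (τ p) (x p)).toENNReal ∂μ ≠ ∞ := by
    refine ne_top_of_le_ne_top (b := ∫⁻ _, ENNReal.ofReal K ∂μ) ?_ (lintegral_mono_ae ?_)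
    · rw [lintegral_const]
      exact ENNReal.mul_ne_top ENNReal.ofReal_ne_top (measure_ne_top _ _)
    · filter_upwards [hM] with p hp
      exact EReal.toENNReal_le_toENNReal (hK _ _ hp)
  have hint : Integrable (fun p => (instantUtility U (τ p) (x p)).toReal) μ := by
    refine ⟨hm.ereal_toReal.aestronglyMeasurable, ?_⟩
    rw [hasFiniteIntegral_iff_norm]
    have hn : ∀ r : ℝ, ENNReal.ofReal ‖r‖ = ENNReal.ofReal r + ENNReal.ofReal (-r) := by
      intro r
      rcases le_total 0 r with h | h
      · rw [Real.norm_of_nonneg h, ENNReal.ofReal_of_nonpos (neg_nonpos.2 h), add_zero]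
      · rw [Real.norm_of_nonpos h, ENNReal.ofReal_of_nonpos h, zero_add]
    simp only [hn]
    rw [lintegral_add_left hm.ereal_toReal.ennreal_ofReal, ← hposE, ← hnegE]
    exact ENNReal.add_lt_top.2 ⟨hpos.lt_top, hneg.lt_top⟩
  refine ⟨hbot, hint, ?_⟩
  rw [expectedUtility, if_neg hneg, integral_eq_lintegral_pos_part_sub_lintegral_neg_part hint,
    ← hposE, ← hnegE, EReal.coe_sub, EReal.coe_ennreal_toReal hpos,
    EReal.coe_ennreal_toReal hneg]

/-- `c` maximizes the expected utility `U` over the budget set at prices `q` given by the endowment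
`e` and the cap `Γ`. -/
structure IsOptimalChoice (τ : X → Time T) (U : Time T → ℝ → ℝ) (q : StrongDual ℝ (Lp ℝ ∞ μ))
    (e : X → ℝ) (Γ : X → ℝ≥0∞) (c : Lp ℝ ∞ μ) : Prop where
  regular : IsRegularUtility U
  measurable_time : Measurable τ
  measurable_cap : Measurable Γ
  uncapped : 0 < μ {p | Γ p = ∞}
  measurable_endowment : Measurable e
  endowment_bounds : ∃ ε : ℝ, 0 < ε ∧ ∀ᵐ p ∂μ, ε ≤ e p ∧ e p ≤ 1 / ε
  cap_gt : ∀ᵐ p ∂μ, ENNReal.ofReal (e p) < Γ p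
  admissible : ∀ᵐ p ∂μ, 0 ≤ c p ∧ ENNReal.ofReal (c p) ≤ Γ p
  budget : q c ≤ q (boundedClass μ e)
  optimal : ∀ x : Lp ℝ ∞ μ, (∀ᵐ p ∂μ, 0 ≤ x p ∧ ENNReal.ofReal (x p) ≤ Γ p) →
    q x ≤ q (boundedClass μ e) → expectedUtility μ τ U x ≤ expectedUtility μ τ U c

namespace IsOptimalChoice

variable {τ : X → Time T} {U : Time T → ℝ → ℝ}
  {q : StrongDual ℝ (Lp ℝ ∞ μ)} {e : X → ℝ} {Γ : X → ℝ≥0∞} {c : Lp ℝ ∞ μ}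

theorem measurable_coe (f : Lp ℝ ∞ μ) : Measurable f :=
  (Lp.stronglyMeasurable f).measurable

theorem memLp_endowment (h : IsOptimalChoice τ U q e Γ c) : MemLp e ∞ μ := by
  obtain ⟨ε, hε, hb⟩ := h.endowment_bounds
  refine memLp_top_of_bound h.measurable_endowment.aestronglyMeasurable (1 / ε) ?_
  filter_upwards [hb] with p hp
  rw [Real.norm_of_nonneg (hε.le.trans hp.1)]
  exact hp.2

theorem not_ae_capped (h : IsOptimalChoice τ U q e Γ c) :
    ¬ ∀ᵐ p ∂μ, ¬ ENNReal.ofReal (c p) < Γ p := by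
  intro h0
  refine h.uncapped.ne' (measure_mono_null (fun p hp => ?_) h0)
  rw [mem_ofPred_eq] at hp
  simp [hp]

theorem endowment_admissible (h : IsOptimalChoice τ U q e Γ c) :
    ∀ᵐ p ∂μ, 0 ≤ boundedClass μ e p ∧ ENNReal.ofReal (boundedClass μ e p) ≤ Γ p := by
  obtain ⟨ε, hε, hb⟩ := h.endowment_bounds
  filter_upwards [hb, h.cap_gt, boundedClass_ae_eq h.memLp_endowment] with p h1 h2 h3
  rw [h3]
  exact ⟨hε.le.trans h1.1, h2.le⟩

variable [IsFiniteMeasure μ]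

/-- The endowment is affordable and bounded away from `0`, so it has finite utility, and the optimum
cannot be worse. -/
theorem lintegral_neg_ne_top (h : IsOptimalChoice τ U q e Γ c) :
    ∫⁻ p, (-instantUtility U (τ p) (c p)).toENNReal ∂μ ≠ ∞ := by
  intro htop
  have hle := h.optimal _ h.endowment_admissible le_rfl
  obtain ⟨ε, hε, hb⟩ := h.endowment_bounds
  obtain ⟨K, hK⟩ := h.regular.exists_le_instantUtility hε
  have hneg : ∫⁻ p, (-instantUtility U (τ p) (boundedClass μ e p)).toENNReal ∂μ ≠ ∞ := by
    refine ne_top_of_le_ne_top (b := ∫⁻ _, ENNReal.ofReal (-K) ∂μ) ?_ (lintegral_mono_ae ?_)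
    · rw [lintegral_const]
      exact ENNReal.mul_ne_top ENNReal.ofReal_ne_top (measure_ne_top _ _)
    · filter_upwards [hb, boundedClass_ae_eq h.memLp_endowment] with p h1 h2
      rw [← EReal.real_coe_toENNReal, EReal.coe_neg]
      refine EReal.toENNReal_le_toENNReal (EReal.neg_le_neg_iff.2 (hK _ _ ?_))
      rw [h2]
      exact h1.1
  obtain ⟨M, hM⟩ := exists_ae_le (boundedClass μ e)
  have hE := (h.regular.expectedUtility_eq h.measurable_time (measurable_coe _) hM hneg).2.2
  rw [hE, expectedUtility, if_pos htop, le_bot_iff] at hle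
  exact EReal.coe_ne_bot _ hle

theorem ae_instantUtility_ne_bot (h : IsOptimalChoice τ U q e Γ c) :
    ∀ᵐ p ∂μ, instantUtility U (τ p) (c p) ≠ ⊥ := by
  obtain ⟨M, hM⟩ := exists_ae_le c
  exact (h.regular.expectedUtility_eq h.measurable_time (measurable_coe _) hM
    h.lintegral_neg_ne_top).1

/-- No affordable choice has a utility that exceeds that of the optimal one by an integrable
function of positive integral. -/
theorem integral_nonpos (h : IsOptimalChoice τ U q e Γ c) {x : Lp ℝ ∞ μ}
    (hx : ∀ᵐ p ∂μ, 0 ≤ x p ∧ ENNReal.ofReal (x p) ≤ Γ p) (hqx : q x ≤ q (boundedClass μ e))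
    {g : X → ℝ} (hg : Integrable g μ)
    (hle : ∀ᵐ p ∂μ, instantUtility U (τ p) (c p) + (g p : EReal) ≤
      instantUtility U (τ p) (x p)) : ∫ p, g p ∂μ ≤ 0 := by
  obtain ⟨M, hM⟩ := exists_ae_le c
  obtain ⟨hcb, hci, hcE⟩ := h.regular.expectedUtility_eq h.measurable_time (measurable_coe c) hM
    h.lintegral_neg_ne_top
  have hle' : ∀ᵐ p ∂μ, (((instantUtility U (τ p) (c p)).toReal + g p : ℝ) : EReal) ≤
      instantUtility U (τ p) (x p) := by
    filter_upwards [hle, hcb] with p h1 h2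
    rwa [EReal.coe_add, EReal.coe_toReal (instantUtility_ne_top _ _) h2]
  -- The utility of `x` lies above an integrable function, which excludes the `-∞` branch of the
  -- functional.
  have hneg : ∫⁻ p, (-instantUtility U (τ p) (x p)).toENNReal ∂μ ≠ ∞ := by
    refine ne_top_of_le_ne_top (hci.add hg).2.ne (lintegral_mono_ae ?_)
    filter_upwards [hle'] with p hp
    refine (EReal.toENNReal_le_toENNReal (EReal.neg_le_neg_iff.2 hp)).trans ?_
    rw [← EReal.coe_neg, EReal.real_coe_toENNReal, Real.enorm_eq_ofReal_abs]
    exact ENNReal.ofReal_le_ofReal (neg_le_abs _)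
  obtain ⟨N, hN⟩ := exists_ae_le x
  obtain ⟨hxb, hxi, hxE⟩ := h.regular.expectedUtility_eq h.measurable_time (measurable_coe x) hN
    hneg
  have hopt := h.optimal x hx hqx
  rw [hcE, hxE, EReal.coe_le_coe_iff] at hopt
  have hmono : ∫ p, ((instantUtility U (τ p) (c p)).toReal + g p) ∂μ ≤
      ∫ p, (instantUtility U (τ p) (x p)).toReal ∂μ := by
    refine integral_mono_ae (hci.add hg) hxi ?_
    filter_upwards [hle', hxb] with p h1 h2
    rwa [← EReal.coe_toReal (instantUtility_ne_top _ _) h2, EReal.coe_le_coe_iff] at h1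
  rw [integral_add hci hg] at hmono
  linarith

/-- Nonsatiation: no affordable choice dominates the optimal one, except itself. -/
theorem ae_eq_of_ae_le (h : IsOptimalChoice τ U q e Γ c) {x : Lp ℝ ∞ μ}
    (hx : ∀ᵐ p ∂μ, ENNReal.ofReal (x p) ≤ Γ p) (hqx : q x ≤ q (boundedClass μ e))
    (hcx : ∀ᵐ p ∂μ, c p ≤ x p) : ∀ᵐ p ∂μ, x p = c p := by
  have hU := h.regular
  -- Truncation at `1` makes the utility gain integrable. It is nonnegative with nonpositive
  -- integral, hence zero, and strict monotonicity then forces `x = c`.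
  set g : X → ℝ := fun p => min 1 ((instantUtility U (τ p) (x p)).toReal -
    (instantUtility U (τ p) (c p)).toReal) with hgd
  have hgm : Measurable g := measurable_const.min
    ((hU.measurable_instantUtility h.measurable_time (measurable_coe x)).ereal_toReal.sub
      (hU.measurable_instantUtility h.measurable_time (measurable_coe c)).ereal_toReal)
  have hcoe : ∀ᵐ p ∂μ, ∃ u v : ℝ, instantUtility U (τ p) (c p) = u ∧
      instantUtility U (τ p) (x p) = v ∧ u ≤ v ∧ g p = min 1 (v - u) := by
    filter_upwards [h.ae_instantUtility_ne_bot, hcx] with p h1 h2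
    have h3 := hU.instantUtility_mono (τ p) h2
    have h4 := EReal.coe_toReal (instantUtility_ne_top (U := U) (τ p) (c p)) h1
    have h5 := EReal.coe_toReal (instantUtility_ne_top (U := U) (τ p) (x p))
      (ne_bot_of_le_ne_bot h1 h3)
    refine ⟨_, _, h4.symm, h5.symm, ?_, rfl⟩
    rwa [← EReal.coe_le_coe_iff, h4, h5]
  have hg0 : 0 ≤ᵐ[μ] g := by
    filter_upwards [hcoe] with p ⟨u, v, _, _, huv, hgp⟩
    rw [hgp]
    exact le_min zero_le_one (sub_nonneg.2 huv)
  have hgi : Integrable g μ := by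
    refine Integrable.of_bound hgm.aestronglyMeasurable 1 ?_
    filter_upwards [hg0] with p hp
    rw [Real.norm_of_nonneg hp]
    exact min_le_left _ _
  have hnp := h.integral_nonpos (x := x) (by
    filter_upwards [hx, hcx, h.admissible] with p h1 h2 h3 using ⟨h3.1.trans h2, h1⟩) hqx hgi (by
    filter_upwards [hcoe] with p ⟨u, v, hu, hv, huv, hgp⟩
    rw [hu, hv, ← EReal.coe_add, EReal.coe_le_coe_iff, hgp]
    linarith [min_le_right 1 (v - u)])
  have hz := (integral_eq_zero_iff_of_nonneg_ae hg0 hgi).1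
    (le_antisymm hnp (integral_nonneg_of_ae hg0))
  filter_upwards [hz, hcoe, hcx, h.admissible] with p h1 ⟨u, v, hu, hv, huv, hgp⟩ h3 h4
  rcases h3.eq_or_lt with h5 | h5
  · exact h5.symm
  · exfalso
    have h6 := hU.instantUtility_lt (τ p) h4.1 h5
    rw [hu, hv, EReal.coe_lt_coe_iff] at h6
    rw [hgp] at h1
    have : 0 < min 1 (v - u) := lt_min one_pos (sub_pos.2 h6)
    exact this.ne' h1

/-- Otherwise the affordable endowment would dominate `c`, and nonsatiation would make it vanish. -/
theorem measure_pos_ne_zero (h : IsOptimalChoice τ U q e Γ c) : ¬ ∀ᵐ p ∂μ, c p ≤ 0 := by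
  intro h0
  obtain ⟨ε, hε, hb⟩ := h.endowment_bounds
  have heq := h.ae_eq_of_ae_le (h.endowment_admissible.mono fun _ hp => hp.2) le_rfl (by
    filter_upwards [h0, h.endowment_admissible] with p h1 h2 using h1.trans h2.1)
  have hF : ∀ᵐ p ∂μ, False := by
    filter_upwards [heq, h0, hb, boundedClass_ae_eq h.memLp_endowment] with p h1 h2 h3 h4
    rw [h4] at h1
    linarith [h3.1]
  have hμ : μ univ = 0 := by simpa [ae_iff] using hF
  exact h.uncapped.ne' (measure_mono_null (subset_univ _) hμ)

/-- The cost of consumption on small sets is small. -/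
theorem exists_cost_le (h : IsOptimalChoice τ U q e Γ c) (hq : IsPositiveUnital q) {κ : ℝ}
    (hκ : 0 < κ) : ∃ ρ : ℝ≥0∞, 0 < ρ ∧ ∀ A : Set X, MeasurableSet A → μ A < ρ →
      q (boundedClass μ (A.indicator c)) ≤ κ := by
  have hU := h.regular
  -- Half of the assumed savings `κ` pays for keeping up to `η` on `A`, the other half for the extra
  -- `η` on `G`.
  set η : ℝ := κ / 2 with hη
  have hη0 : 0 < η := half_pos hκ
  set G : Set X := {p | Γ p = ∞} with hG
  have hGm : MeasurableSet G := h.measurable_cap (measurableSet_singleton ∞)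
  obtain ⟨M, hM⟩ := exists_ae_le c
  obtain ⟨K₁, hK₁⟩ := hU.exists_le_instantUtility hη0
  obtain ⟨K₂, hK₂⟩ := hU.exists_instantUtility_le M
  have hcm := measurable_coe c
  set w : X → ℝ := fun p => min 1 ((instantUtility U (τ p) (c p + η)).toReal -
    (instantUtility U (τ p) (c p)).toReal) with hwd
  have hwm : Measurable w := measurable_const.min
    ((hU.measurable_instantUtility h.measurable_time (hcm.add_const η)).ereal_toReal.sub
      (hU.measurable_instantUtility h.measurable_time hcm).ereal_toReal)
  have hw : ∀ᵐ p ∂μ, 0 < w p ∧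
      instantUtility U (τ p) (c p) + (w p : EReal) ≤ instantUtility U (τ p) (c p + η) := by
    filter_upwards [h.ae_instantUtility_ne_bot, h.admissible] with p h1 h2
    have h3 := hU.instantUtility_lt (τ p) h2.1 (lt_add_of_pos_right (c p) hη0)
    have h4 := EReal.coe_toReal (instantUtility_ne_top (U := U) (τ p) (c p)) h1
    have h5 := EReal.coe_toReal (instantUtility_ne_top (U := U) (τ p) (c p + η))
      (ne_bot_of_gt h3)
    rw [← h4, ← h5, EReal.coe_lt_coe_iff] at h3
    refine ⟨lt_min one_pos (sub_pos.2 h3), ?_⟩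
    rw [← h4, ← h5, ← EReal.coe_add, EReal.coe_le_coe_iff, hwd]
    linarith [min_le_right 1 ((instantUtility U (τ p) (c p + η)).toReal -
      (instantUtility U (τ p) (c p)).toReal)]
  have hw1 : ∀ p, w p ≤ 1 := fun p => min_le_left _ _
  have hwi : Integrable w μ := by
    refine Integrable.of_bound hwm.aestronglyMeasurable 1 ?_
    filter_upwards [hw] with p hp
    rw [Real.norm_of_nonneg hp.1.le]
    exact hw1 p
  have hH : 0 < ∫ p in G, w p ∂μ := by
    rw [setIntegral_pos_iff_support_of_nonneg_ae
      (ae_restrict_of_ae (hw.mono fun p hp => hp.1.le)) hwi.integrableOn]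
    refine h.uncapped.trans_le (measure_mono_ae ?_)
    filter_upwards [hw] with p hp hpG
    exact ⟨hp.1.ne', hpG⟩
  -- On `A` the loss from a cut to `η` is at most `K₂ - K₁`; the summand `1` absorbs `w ≤ 1` on `A ∩
  -- G`, where the bonus is credited but not consumed.
  set D : ℝ := 1 + |K₁| + |K₂| with hD
  have hD0 : 0 < D := by positivity
  refine ⟨ENNReal.ofReal ((∫ p in G, w p ∂μ) / D), ENNReal.ofReal_pos.2 (div_pos hH hD0),
    fun A hA hμA => ?_⟩
  by_contra! hcost
  classical
  set f : X → ℝ := fun p => if p ∈ A then min (c p) η else if p ∈ G then c p + η else c p with hf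
  have hfm : Measurable f := Measurable.ite hA (hcm.min measurable_const)
    (Measurable.ite hGm (hcm.add_const η) hcm)
  have hfb : ∀ᵐ p ∂μ, 0 ≤ f p ∧ f p ≤ M + η ∧ ENNReal.ofReal (f p) ≤ Γ p := by
    filter_upwards [h.admissible, hM] with p h1 h2
    simp only [hf]
    split_ifs with h3 h4
    · exact ⟨le_min h1.1 hη0.le, (min_le_left _ _).trans (by linarith),
        (ENNReal.ofReal_le_ofReal (min_le_left _ _)).trans h1.2⟩
    · refine ⟨by linarith [h1.1], by linarith, ?_⟩
      rw [show Γ p = ∞ from h4]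
      exact le_top
    · exact ⟨h1.1, by linarith, h1.2⟩
  have hfL : MemLp f ∞ μ := by
    refine memLp_top_of_bound hfm.aestronglyMeasurable (M + η) ?_
    filter_upwards [hfb] with p hp
    rw [Real.norm_of_nonneg hp.1]
    exact hp.2.1
  have hfe := boundedClass_ae_eq hfL
  have hcA : MemLp (A.indicator c) ∞ μ := (Lp.memLp c).indicator hA
  -- Pointwise `f ≤ c - 1_A c + η`, and constants cost their value, so the price of `f` is at most
  -- `q c - κ + η`.
  have hbudget : q (boundedClass μ f) ≤ q c := by
    have hle : q (boundedClass μ f) ≤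
        q (c - boundedClass μ (A.indicator c) + η • boundedClass μ fun _ => 1) := by
      refine hq.mono ?_
      filter_upwards [hfe, boundedClass_ae_eq hcA,
        boundedClass_ae_eq (μ := μ) (memLp_const (1 : ℝ)),
        Lp.coeFn_add (c - boundedClass μ (A.indicator c)) (η • boundedClass μ fun _ => 1),
        Lp.coeFn_sub c (boundedClass μ (A.indicator c)),
        Lp.coeFn_smul η (boundedClass μ fun _ => (1 : ℝ))] with p h1 h2 h3 h4 h5 h6
      rw [h1, h4, Pi.add_apply, h5, h6, Pi.sub_apply, Pi.smul_apply, h2, h3, smul_eq_mul, mul_one]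
      by_cases hpA : p ∈ A
      · simp [hf, hpA]
      · by_cases hpG : p ∈ G
        · simp [hf, hpA, hpG]
        · simp [hf, hpA, hpG, hη0.le]
    rw [map_add, map_sub, map_smul, hq.total, smul_eq_mul, mul_one] at hle
    linarith
  have hAi : Integrable (A.indicator fun _ => D) μ := (integrable_const D).indicator hA
  have hnp := h.integral_nonpos (x := boundedClass μ f) (by
      filter_upwards [hfe, hfb] with p h1 h2
      rw [h1]
      exact ⟨h2.1, h2.2.2⟩) (hbudget.trans h.budget) ((hwi.indicator hGm).sub hAi) (by
    filter_upwards [hfe, hw, hM, h.ae_instantUtility_ne_bot] with p h1 h2 h3 h4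
    have h5 := EReal.coe_toReal (instantUtility_ne_top (U := U) (τ p) (c p)) h4
    have h6 : G.indicator w p ≤ 1 := by
      by_cases hpG : p ∈ G
      · simpa [hpG] using hw1 p
      · simp [hpG]
    rw [h1, Pi.sub_apply]
    by_cases hpA : p ∈ A
    · simp only [hf, hpA, if_true, indicator_of_mem]
      rcases le_or_gt (c p) η with h7 | h7
      · rw [min_eq_left h7, ← h5, ← EReal.coe_add, EReal.coe_le_coe_iff]
        linarith [abs_nonneg K₁, abs_nonneg K₂]
      · rw [min_eq_right h7.le]
        refine le_trans ?_ (hK₁ (τ p) η le_rfl)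
        have h8 := hK₂ (τ p) _ h3
        rw [← h5, EReal.coe_le_coe_iff] at h8
        rw [← h5, ← EReal.coe_add, EReal.coe_le_coe_iff]
        linarith [neg_abs_le K₁, le_abs_self K₂]
    · by_cases hpG : p ∈ G
      · simpa [hf, hpA, hpG] using h2.2
      · simp [hf, hpA, hpG])
  simp only [Pi.sub_apply] at hnp
  rw [integral_sub (hwi.indicator hGm) hAi, integral_indicator hGm, integral_indicator hA,
    setIntegral_const, smul_eq_mul] at hnp
  have h9 : μ.real A < (∫ p in G, w p ∂μ) / D := by
    rw [measureReal_def]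
    exact ENNReal.toReal_lt_of_lt_ofReal hμA
  rw [lt_div_iff₀ hD0] at h9
  linarith

end IsOptimalChoice

end Choice

/-! ### The first-order conditions -/

section FirstOrder

variable {T : ℝ} {X : Type*} {mX : MeasurableSpace X} {μ : Measure X}

/-- `Q` is a density of the set function of `q`. -/
structure IsPriceDensity (q : StrongDual ℝ (Lp ℝ ∞ μ)) (Q : X → ℝ) : Prop where
  measurable : Measurable Q
  integrable : Integrable Q μ
  mass_eq : ∀ A : Set X, MeasurableSet A → mass q A = ∫ p in A, Q p ∂μ

theorem IsPriceDensity.mass_pos {q : StrongDual ℝ (Lp ℝ ∞ μ)} {Q : X → ℝ}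
    (hQ : IsPriceDensity q Q) (hQ0 : ∀ᵐ p ∂μ, 0 < Q p) {A : Set X} (hA : MeasurableSet A)
    (hμA : μ A ≠ 0) : 0 < mass q A := by
  rw [hQ.mass_eq A hA, setIntegral_pos_iff_support_of_nonneg_ae
    (ae_restrict_of_ae (hQ0.mono fun p hp => hp.le)) hQ.integrable.integrableOn]
  refine (pos_iff_ne_zero.2 hμA).trans_le (measure_mono_ae ?_)
  filter_upwards [hQ0] with p hp hpA
  exact ⟨hp.ne', hpA⟩

theorem IsRegularUtility.midpoint_le {U : Time T → ℝ → ℝ} (hU : IsRegularUtility U) (t : Time T)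
    {x δ : ℝ} (hδ : 0 < δ) (hδx : δ < x) : U t (x + δ) + U t (x - δ) ≤ 2 * U t x := by
  have hc := (hU.strictConcave t).concaveOn.2
    (show x + δ ∈ Ioi (0 : ℝ) by simp only [mem_Ioi]; linarith)
    (show x - δ ∈ Ioi (0 : ℝ) by simp only [mem_Ioi]; linarith)
    (show (0 : ℝ) ≤ 1 / 2 by norm_num) (show (0 : ℝ) ≤ 1 / 2 by norm_num) (by norm_num)
  simp only [smul_eq_mul] at hc
  have he : 1 / 2 * (x + δ) + 1 / 2 * (x - δ) = x := by ring
  rw [he] at hc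
  linarith

namespace IsOptimalChoice

variable {τ : X → Time T} {U : Time T → ℝ → ℝ}
  {q : StrongDual ℝ (Lp ℝ ∞ μ)} {e : X → ℝ} {Γ : X → ℝ≥0∞} {c : Lp ℝ ∞ μ}

variable [IsFiniteMeasure μ]

/-- Prices are positive wherever the cap does not bind. -/
theorem ae_density_pos (h : IsOptimalChoice τ U q e Γ c) (hq : IsPositiveUnital q) {Q : X → ℝ}
    (hQ : IsPriceDensity q Q) : ∀ᵐ p ∂μ, ENNReal.ofReal (c p) < Γ p → 0 < Q p := by
  have hcm := measurable_coe c
  set A : Set X := {p | Q p ≤ 0} with hAd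
  have hA : MeasurableSet A := measurableSet_le hQ.measurable measurable_const
  have hA0 : mass q A ≤ 0 := by
    rw [hQ.mass_eq A hA]
    exact setIntegral_nonpos hA fun p hp => hp
  -- Fill the room below the cap, at most one unit to stay bounded, where prices are nonpositive.
  -- The addition costs nothing, so nonsatiation makes it vanish.
  set s : X → ℝ := A.indicator fun p => (min 1 (Γ p - ENNReal.ofReal (c p))).toReal with hs
  have hsm : Measurable s :=
    (measurable_const.min (h.measurable_cap.sub hcm.ennreal_ofReal)).ennreal_toReal.indicator hA
  have hs0 : ∀ p, 0 ≤ s p := indicator_nonneg fun p _ => ENNReal.toReal_nonneg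
  have hs1 : ∀ p, s p ≤ A.indicator (fun _ => 1) p := fun p =>
    indicator_le_indicator (ENNReal.toReal_mono ENNReal.one_ne_top (min_le_left _ _))
  have hsL : MemLp s ∞ μ := by
    refine memLp_top_of_bound hsm.aestronglyMeasurable 1 (Eventually.of_forall fun p => ?_)
    rw [Real.norm_of_nonneg (hs0 p)]
    exact (hs1 p).trans (indicator_le_self' (fun _ _ => zero_le_one) p)
  have hse := boundedClass_ae_eq hsL
  have hadd := Lp.coeFn_add c (boundedClass μ s)
  have hqs : q (boundedClass μ s) ≤ 0 := by
    refine le_trans (hq.mono ?_) hA0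
    filter_upwards [hse, boundedClass_indicator_ae_eq (μ := μ) hA] with p h1 h2
    rw [h1, h2]
    exact hs1 p
  have heq := h.ae_eq_of_ae_le (x := c + boundedClass μ s) (by
      filter_upwards [hse, hadd, h.admissible] with p h1 h2 h3
      rw [h2, Pi.add_apply, h1, ENNReal.ofReal_add h3.1 (hs0 p)]
      have h4 : ENNReal.ofReal (s p) ≤ Γ p - ENNReal.ofReal (c p) := by
        by_cases hp : p ∈ A
        · simp only [hs, hp, indicator_of_mem]
          rw [ENNReal.ofReal_toReal (ne_top_of_le_ne_top ENNReal.one_ne_top (min_le_left _ _))]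
          exact min_le_right _ _
        · simp [hs, hp]
      calc ENNReal.ofReal (c p) + ENNReal.ofReal (s p)
          ≤ ENNReal.ofReal (c p) + (Γ p - ENNReal.ofReal (c p)) := by gcongr
        _ = Γ p := add_tsub_cancel_of_le h3.2) (by
      rw [map_add]
      linarith [h.budget]) (by
      filter_upwards [hse, hadd] with p h1 h2
      rw [h2, Pi.add_apply, h1]
      linarith [hs0 p])
  filter_upwards [heq, hse, hadd] with p h1 h2 h3 h4
  by_contra! hp
  rw [h3, Pi.add_apply, h2] at h1
  have h5 : s p = 0 := by linarith
  simp only [hs, show p ∈ A from hp, indicator_of_mem] at h5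
  rw [ENNReal.toReal_eq_zero_iff] at h5
  rcases h5 with h5 | h5
  · rcases min_eq_iff.1 h5 with h6 | h6
    · exact one_ne_zero h6.1
    · exact (tsub_pos_of_lt h4).ne' h6.1
  · exact ne_top_of_le_ne_top ENNReal.one_ne_top (min_le_left _ _) h5

/-- It does not pay to transfer consumption from a set `A` to a set `B`. -/
theorem measure_eq_zero_or (h : IsOptimalChoice τ U q e Γ c) (hq : IsPositiveUnital q)
    {Q : X → ℝ} (hQ : IsPriceDensity q Q) (hQ0 : ∀ᵐ p ∂μ, 0 < Q p) {A B : Set X}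
    (hA : MeasurableSet A) (hB : MeasurableSet B) {a b δ : ℝ} (hab : a < b) (hδ : 0 < δ)
    (hpA : ∀ᵐ p ∂μ, p ∈ A → 2 * δ ≤ c p ∧ U (τ p) (c p) ≤ U (τ p) (c p - δ) + a * Q p * δ)
    (hpB : ∀ᵐ p ∂μ, p ∈ B → ENNReal.ofReal (c p + δ) ≤ Γ p ∧
      instantUtility U (τ p) (c p) + ((b * Q p * δ : ℝ) : EReal) ≤
        instantUtility U (τ p) (c p + δ)) :
    μ A = 0 ∨ μ B = 0 := by
  have hU := h.regular
  by_contra! hAB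
  have hmA := hQ.mass_pos hQ0 hA hAB.1
  have hmB := hQ.mass_pos hQ0 hB hAB.2
  -- At a common point the gain from adding `δ` would exceed the loss from removing `δ`, against
  -- concavity.
  have hdisj : ∀ᵐ p ∂μ, p ∈ A → p ∉ B := by
    filter_upwards [hpA, hpB, hQ0] with p h1 h2 h3 h4 h5
    have h6 := h1 h4
    have h7 := (h2 h5).2
    rw [instantUtility_of_pos _ (by linarith), instantUtility_of_pos _ (by linarith),
      ← EReal.coe_add, EReal.coe_le_coe_iff] at h7
    have h8 := hU.midpoint_le (τ p) hδ (by linarith : δ < c p)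
    nlinarith [mul_pos (mul_pos (sub_pos.2 hab) h3) hδ]
  -- Adding `ε₁` on `B` and removing `ε₂` from `A` both have price `δ * q(A) * q(B)`, so the
  -- transfer is budget-neutral; it gains at least `(b - a) * δ * q(A) * q(B)`.
  set ε₁ : ℝ := δ * mass q A with hε₁
  set ε₂ : ℝ := δ * mass q B with hε₂
  have hε₁0 : 0 < ε₁ := mul_pos hδ hmA
  have hε₂0 : 0 < ε₂ := mul_pos hδ hmB
  have hε₁δ : ε₁ ≤ δ := mul_le_of_le_one_right hδ.le (hq.mass_le_one hA)
  have hε₂δ : ε₂ ≤ δ := mul_le_of_le_one_right hδ.le (hq.mass_le_one hB)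
  set yA := boundedClass μ (A.indicator fun _ => (1 : ℝ)) with hyA
  set yB := boundedClass μ (B.indicator fun _ => (1 : ℝ)) with hyB
  set x : Lp ℝ ∞ μ := c + ε₁ • yB - ε₂ • yA with hxd
  have hx : ∀ᵐ p ∂μ, x p = c p + ε₁ * B.indicator (fun _ => (1 : ℝ)) p -
      ε₂ * A.indicator (fun _ => (1 : ℝ)) p := by
    filter_upwards [boundedClass_indicator_ae_eq (μ := μ) hA,
      boundedClass_indicator_ae_eq (μ := μ) hB, Lp.coeFn_sub (c + ε₁ • yB) (ε₂ • yA),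
      Lp.coeFn_add c (ε₁ • yB), Lp.coeFn_smul ε₁ yB, Lp.coeFn_smul ε₂ yA] with p h1 h2 h3 h4 h5 h6
    rw [h3, Pi.sub_apply, h4, Pi.add_apply, h5, h6, Pi.smul_apply, Pi.smul_apply, h1, h2,
      smul_eq_mul, smul_eq_mul]
  have hqx : q x = q c := by
    have h1 : q yA = mass q A := rfl
    have h2 : q yB = mass q B := rfl
    rw [hxd, map_sub, map_add, map_smul, map_smul, h1, h2, smul_eq_mul, smul_eq_mul, hε₁, hε₂]
    ring
  have hBi := (hQ.integrable.indicator hB).const_mul (ε₁ * b)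
  have hAi := (hQ.integrable.indicator hA).const_mul (ε₂ * a)
  have hnp := h.integral_nonpos (x := x) (by
      filter_upwards [hx, hdisj, hpA, hpB, h.admissible] with p h1 h2 h3 h4 h5
      rw [h1]
      by_cases hA' : p ∈ A
      · simp only [hA', h2 hA', indicator_of_mem, not_false_eq_true, indicator_of_notMem]
        refine ⟨by linarith [(h3 hA').1], le_trans (ENNReal.ofReal_le_ofReal ?_) h5.2⟩
        linarith
      · by_cases hB' : p ∈ B
        · simp only [hA', hB', indicator_of_mem, not_false_eq_true, indicator_of_notMem]
          refine ⟨by linarith [h5.1], le_trans (ENNReal.ofReal_le_ofReal ?_) (h4 hB').1⟩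
          linarith
        · simpa [hA', hB'] using h5) (hqx.trans_le h.budget) (hBi.sub hAi) (by
    filter_upwards [hx, hdisj, hpA, hpB, h.admissible] with p h1 h2 h3 h4 h5
    rw [h1, Pi.sub_apply]
    by_cases hA' : p ∈ A
    · simp only [hA', h2 hA', indicator_of_mem, not_false_eq_true, indicator_of_notMem]
      have h6 := h3 hA'
      have h7 := hU.le_sub_add (τ p) (by linarith : δ < c p) hε₂0 hε₂δ h6.2
      rw [instantUtility_of_pos _ (by linarith), instantUtility_of_pos _ (by linarith),
        ← EReal.coe_add, EReal.coe_le_coe_iff, mul_zero, mul_zero, mul_one, add_zero]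
      linarith
    · by_cases hB' : p ∈ B
      · simp only [hA', hB', indicator_of_mem, not_false_eq_true, indicator_of_notMem]
        have h7 := hU.instantUtility_add_le (τ p) h5.1 hε₁0 hε₁δ (h4 hB').2
        rw [mul_one, mul_zero, mul_zero, sub_zero, sub_zero]
        convert h7 using 3
        ring
      · simp [hA', hB'])
  simp only [Pi.sub_apply] at hnp
  rw [integral_sub hBi hAi, integral_const_mul, integral_const_mul, integral_indicator hA,
    integral_indicator hB, ← hQ.mass_eq A hA, ← hQ.mass_eq B hB, hε₁, hε₂] at hnp
  nlinarith [mul_pos (mul_pos (mul_pos hδ hmA) hmB) (sub_pos.2 hab)]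

/-- The first-order conditions, with a Lagrange multiplier. -/
theorem exists_multiplier (h : IsOptimalChoice τ U q e Γ c) (hq : IsPositiveUnital q)
    {Q : X → ℝ} (hQ : IsPriceDensity q Q) (hQ0 : ∀ᵐ p ∂μ, 0 < Q p) :
    ∃ lam : ℝ, 0 < lam ∧ ∀ᵐ p ∂μ,
      ENNReal.ofReal (c p) = min (Γ p) (ENNReal.ofReal (invMarginal U (τ p) (lam * Q p))) := by
  have hU := h.regular
  have hcm := measurable_coe c
  have hQm := hQ.measurable
  let δ : ℕ → ℝ := fun n => 1 / ((n : ℝ) + 1)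
  have hδ0 : ∀ n, 0 < δ n := fun n => by positivity
  have hδa : ∀ {m n : ℕ}, m ≤ n → δ n ≤ δ m := fun hmn =>
    one_div_le_one_div_of_le (by positivity) (by gcongr)
  have hδt : Tendsto δ atTop (𝓝 0) := tendsto_one_div_add_atTop_nhds_zero_nat
  have hum : ∀ {f : X → ℝ}, Measurable f → Measurable fun p => instantUtility U (τ p) (f p) :=
    fun hf => hU.measurable_instantUtility h.measurable_time hf
  -- Difference-quotient versions of `U'(c) ≤ a Q` and, with room below the cap, of `U'(c) ≥ b Q`.
  -- The factor `2` keeps `c - δ n` positive, where utility is finite.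
  let A : ℝ → ℕ → Set X := fun a n => {p | 2 * δ n ≤ c p} ∩
    {p | instantUtility U (τ p) (c p) ≤
      instantUtility U (τ p) (c p - δ n) + ((a * Q p * δ n : ℝ) : EReal)}
  let B : ℝ → ℕ → Set X := fun b n => {p | ENNReal.ofReal (c p + δ n) ≤ Γ p} ∩
    {p | instantUtility U (τ p) (c p) + ((b * Q p * δ n : ℝ) : EReal) ≤
      instantUtility U (τ p) (c p + δ n)}
  have hAm : ∀ a n, MeasurableSet (A a n) := fun a n =>
    (measurableSet_le measurable_const hcm).inter (measurableSet_le (hum hcm)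
      ((hum (hcm.sub_const _)).add (((hQm.const_mul a).mul_const _).coe_real_ereal)))
  have hBm : ∀ b n, MeasurableSet (B b n) := fun b n =>
    (measurableSet_le (hcm.add_const _).ennreal_ofReal h.measurable_cap).inter
      (measurableSet_le ((hum hcm).add (((hQm.const_mul b).mul_const _).coe_real_ereal))
        (hum (hcm.add_const _)))
  have hAr : ∀ {a n p}, p ∈ A a n →
      2 * δ n ≤ c p ∧ U (τ p) (c p) ≤ U (τ p) (c p - δ n) + a * Q p * δ n := by
    intro a n p hp
    have h1 : 2 * δ n ≤ c p := hp.1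
    have h2 := hp.2
    have h3 := hδ0 n
    rw [mem_ofPred_eq, instantUtility_of_pos _ (by linarith), instantUtility_of_pos _ (by linarith),
      ← EReal.coe_add, EReal.coe_le_coe_iff] at h2
    exact ⟨h1, h2⟩
  have hAmono : ∀ a {m n : ℕ}, m ≤ n → A a m ⊆ A a n := by
    intro a m n hmn p hp
    obtain ⟨h1, h2⟩ := hAr hp
    have h3 := hδ0 n
    have h4 := hδa hmn
    refine ⟨show 2 * δ n ≤ c p by linarith, ?_⟩
    rw [mem_ofPred_eq, instantUtility_of_pos _ (by linarith), instantUtility_of_pos _ (by linarith),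
      ← EReal.coe_add, EReal.coe_le_coe_iff]
    exact hU.le_sub_add (τ p) (by linarith) h3 h4 h2
  have hBmono : ∀ b {m n : ℕ}, m ≤ n → ∀ᵐ p ∂μ, p ∈ B b m → p ∈ B b n := by
    intro b m n hmn
    filter_upwards [h.admissible] with p h1 hp
    refine ⟨le_trans (ENNReal.ofReal_le_ofReal ?_) hp.1,
      hU.instantUtility_add_le (τ p) h1.1 (hδ0 n) (hδa hmn) hp.2⟩
    linarith [hδa hmn]
  -- Both families grow with the index, so the transfer argument can use the common scale `max m n`.
  have hcross : ∀ {a b : ℝ}, a < b → ∀ m n, μ (B b n) ≠ 0 → μ (A a m) = 0 := by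
    intro a b hab m n hBn
    have h1 := h.measure_eq_zero_or hq hQ hQ0 (hAm a (max m n)) (hBm b (max m n)) hab
      (hδ0 (max m n)) (Eventually.of_forall fun p hp => hAr hp)
      (Eventually.of_forall fun p hp => hp)
    rcases h1 with h1 | h1
    · exact measure_mono_null (hAmono a (le_max_left m n)) h1
    · refine absurd (le_antisymm ((measure_mono_ae ?_).trans h1.le) zero_le) hBn
      exact hBmono b (le_max_right m n)
  have hlow : ∀ {a : ℝ}, (∀ m, μ (A a m) = 0) →
      ∀ᵐ p ∂μ, 0 < c p → a * Q p ≤ deriv (U (τ p)) (c p) := by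
    intro a ha
    filter_upwards [ae_all_iff.2 fun m => measure_eq_zero_iff_ae_notMem.1 (ha m)] with p hp hcp
    refine hU.le_deriv_of_forall_le_sub (τ p) hcp ?_
    filter_upwards [hδt.eventually_lt_const (half_pos hcp)] with n hn
    by_contra! hlt
    have h3 := hδ0 n
    refine hp n ⟨show 2 * δ n ≤ c p by linarith, ?_⟩
    rw [mem_ofPred_eq, instantUtility_of_pos _ hcp, instantUtility_of_pos _ (by linarith),
      ← EReal.coe_add, EReal.coe_le_coe_iff]
    exact hlt.le
  have hupp : ∀ {b : ℝ}, (∀ n, μ (B b n) = 0) → ∀ᵐ p ∂μ, ENNReal.ofReal (c p) < Γ p →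
      0 < c p ∧ deriv (U (τ p)) (c p) ≤ b * Q p := by
    intro b hb
    filter_upwards [ae_all_iff.2 fun n => measure_eq_zero_iff_ae_notMem.1 (hb n),
      h.admissible] with p hp h1 hcp
    have hcap : ∀ᶠ n in atTop, ENNReal.ofReal (c p + δ n) ≤ Γ p := by
      have h2 : Tendsto (fun n => ENNReal.ofReal (c p + δ n)) atTop
          (𝓝 (ENNReal.ofReal (c p + 0))) := ENNReal.tendsto_ofReal (hδt.const_add _)
      rw [add_zero] at h2
      exact (h2.eventually_lt_const hcp).mono fun n hn => hn.le
    -- At zero consumption the infinite marginal utility would put `p` into some `B b n`.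
    have hc0 : 0 < c p := by
      refine lt_of_le_of_ne h1.1 fun h0 => ?_
      obtain ⟨n, hn1, hn2⟩ :=
        (hcap.and (hU.eventually_instantUtility_zero_add_lt (τ p) (b * Q p))).exists
      refine hp n ⟨hn1, ?_⟩
      rw [mem_ofPred_eq, ← h0, zero_add]
      exact hn2.le
    refine ⟨hc0, hU.deriv_le_of_forall_add_le (τ p) hc0 (hcap.mono fun n hn => ?_)⟩
    by_contra! hlt
    have h3 := hδ0 n
    refine hp n ⟨hn, ?_⟩
    rw [mem_ofPred_eq, instantUtility_of_pos _ hc0, instantUtility_of_pos _ (by linarith),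
      ← EReal.coe_add, EReal.coe_le_coe_iff]
    exact hlt.le
  -- The multiplier is the supremum of `S`: the essential upper bound of `U'(c) / Q` where the cap
  -- is slack.
  let S : Set ℝ := {k | ∃ n, μ (B k n) ≠ 0}
  have hnotS : ∀ {k}, k ∉ S → ∀ n, μ (B k n) = 0 := by
    intro k hk n
    by_contra hne
    exact hk ⟨n, hne⟩
  -- Were `S` unbounded, `U'(c) ≥ k Q` would hold for every `k` wherever `c > 0`, so `c` would
  -- vanish almost everywhere.
  have hbdd : BddAbove S := by
    by_contra hnb
    rw [not_bddAbove_iff] at hnb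
    refine h.measure_pos_ne_zero ?_
    have hall : ∀ᵐ p ∂μ, ∀ k : ℕ, 0 < c p → (k : ℝ) * Q p ≤ deriv (U (τ p)) (c p) := by
      refine ae_all_iff.2 fun k => hlow fun m => ?_
      obtain ⟨b, ⟨n, hn⟩, hkb⟩ := hnb k
      exact hcross hkb m n hn
    filter_upwards [hall, hQ0] with p h1 h2
    by_contra! h3
    obtain ⟨k, hk⟩ := exists_nat_gt (deriv (U (τ p)) (c p) / Q p)
    rw [div_lt_iff₀ h2] at hk
    linarith [h1 k h3]
  -- Otherwise `U'(c) ≤ 0` wherever the cap is slack, against strict monotonicity; the cap would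
  -- bind almost everywhere, but it is infinite on a nonnull set.
  have hSpos : ∃ k ∈ S, 0 < k := by
    by_contra! hS
    refine h.not_ae_capped ?_
    have hall : ∀ᵐ p ∂μ, ∀ n : ℕ, ENNReal.ofReal (c p) < Γ p →
        0 < c p ∧ deriv (U (τ p)) (c p) ≤ δ n * Q p :=
      ae_all_iff.2 fun n => hupp (hnotS fun hk => (hS _ hk).not_gt (hδ0 n))
    filter_upwards [hall] with p h1 h2
    have hlim : deriv (U (τ p)) (c p) ≤ 0 * Q p :=
      ge_of_tendsto' (hδt.mul_const (Q p)) fun n => (h1 n h2).2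
    have hc0 := (h1 0 h2).1
    have hslope := (hU.strictConcave (τ p)).concaveOn.slope_le_deriv
      (show c p ∈ Ioi (0 : ℝ) from hc0) (show c p + 1 ∈ Ioi (0 : ℝ) by
        simp only [mem_Ioi]; linarith) (by linarith) (hU.differentiableAt (τ p) hc0)
    have hmono := hU.strictMono (τ p) (show c p ∈ Ioi (0 : ℝ) from hc0)
      (show c p + 1 ∈ Ioi (0 : ℝ) by simp only [mem_Ioi]; linarith) (by linarith)
    rw [slope_def_field, add_sub_cancel_left, div_one] at hslope
    linarith
  obtain ⟨k₀, hk₀S, hk₀⟩ := hSpos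
  set lam := sSup S with hlam
  have hlam0 : 0 < lam := hk₀.trans_le (le_csSup hbdd hk₀S)
  have hle : ∀ᵐ p ∂μ, ENNReal.ofReal (c p) < Γ p →
      0 < c p ∧ deriv (U (τ p)) (c p) ≤ lam * Q p := by
    have hall : ∀ᵐ p ∂μ, ∀ n : ℕ, ENNReal.ofReal (c p) < Γ p →
        0 < c p ∧ deriv (U (τ p)) (c p) ≤ (lam + δ n) * Q p :=
      ae_all_iff.2 fun n => hupp (hnotS fun hk =>
        ((le_csSup hbdd hk).trans_lt (lt_add_of_pos_right _ (hδ0 n))).false)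
    filter_upwards [hall] with p h1 h2
    refine ⟨(h1 0 h2).1, ?_⟩
    have hlim := ge_of_tendsto' ((hδt.const_add lam).mul_const (Q p)) fun n => (h1 n h2).2
    rwa [add_zero] at hlim
  have hge : ∀ᵐ p ∂μ, 0 < c p → lam * Q p ≤ deriv (U (τ p)) (c p) := by
    have hall : ∀ᵐ p ∂μ, ∀ n : ℕ, 0 < c p → (lam - δ n) * Q p ≤ deriv (U (τ p)) (c p) := by
      refine ae_all_iff.2 fun n => hlow fun m => ?_
      obtain ⟨b, ⟨j, hj⟩, hkb⟩ :=
        exists_lt_of_lt_csSup ⟨k₀, hk₀S⟩ (sub_lt_self lam (hδ0 n))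
      exact hcross hkb m j hj
    filter_upwards [hall] with p h1 h2
    have hlim := le_of_tendsto' ((hδt.const_sub lam).mul_const (Q p)) fun n => h1 n h2
    rwa [sub_zero] at hlim
  refine ⟨lam, hlam0, ?_⟩
  filter_upwards [hle, hge, h.admissible, h.cap_gt, hQ0] with p h1 h2 h3 h4 h5
  rcases h3.2.lt_or_eq with h6 | h6
  · obtain ⟨h7, h8⟩ := h1 h6
    rw [← le_antisymm h8 (h2 h7), hU.invMarginal_deriv (τ p) h7, min_eq_right h3.2]
  -- When the cap binds, only `lam * Q ≤ U'(c)` is available; since `U'` decreases, it says that the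
  -- uncapped demand is at least `c = Γ`.
  · have h7 : 0 < c p := by
      rw [← ENNReal.ofReal_pos, h6]
      exact zero_le.trans_lt h4
    have h8 := mul_pos hlam0 h5
    rw [← h6, min_eq_left]
    refine ENNReal.ofReal_le_ofReal ?_
    by_contra! h9
    have h10 := hU.strictAntiOn_deriv (τ p) (hU.invMarginal_pos (τ p) h8) h7 h9
    rw [hU.deriv_invMarginal (τ p) h8] at h10
    linarith [h2 h7]

end IsOptimalChoice

end FirstOrder

/-! ### Market clearing -/

section Market

variable {T : ℝ} {X : Type*} {mX : MeasurableSpace X} {μ : Measure X} {d : ℕ} {τ : X → Time T}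
  {U : Fin d → Time T → ℝ → ℝ} {q : StrongDual ℝ (Lp ℝ ∞ μ)} {e : Fin d → X → ℝ}
  {Γ : Fin d → X → ℝ≥0∞} {c : Fin d → Lp ℝ ∞ μ}

/-- In equilibrium the price functional has a density. -/
theorem exists_isPriceDensity [IsFiniteMeasure μ] (hd : 0 < d) (hq : IsPositiveUnital q)
    (h : ∀ i, IsOptimalChoice τ (U i) q (e i) (Γ i) (c i))
    (hclear : ∀ᵐ p ∂μ, ∑ i, c i p = ∑ i, e i p) : ∃ Q, IsPriceDensity q Q := by
  let i₀ : Fin d := ⟨0, hd⟩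
  obtain ⟨ε, hε, hb⟩ := (h i₀).endowment_bounds
  have hd' : (0 : ℝ) < d := Nat.cast_pos.2 hd
  obtain ⟨Q, h1, h2, h3⟩ := hq.exists_density fun κ hκ => by
    have hκ' : 0 < κ * ε / d := by positivity
    choose ρ hρ hρA using fun i => (h i).exists_cost_le hq hκ'
    refine ⟨Finset.univ.inf ρ, (Finset.lt_inf_iff ENNReal.zero_lt_top).2 fun i _ => hρ i,
      fun A hA hμA => ?_⟩
    have hcost : ∀ i, q (boundedClass μ (A.indicator (c i))) ≤ κ * ε / d := fun i =>
      hρA i A hA (hμA.trans_le (Finset.inf_le (Finset.mem_univ i)))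
    -- By clearing, total consumption on `A` equals the total endowment, which is at least `ε`.
    have hle : q (ε • boundedClass μ (A.indicator fun _ => (1 : ℝ))) ≤
        q (∑ i, boundedClass μ (A.indicator (c i))) := by
      refine hq.mono ?_
      have hae : ∀ᵐ p ∂μ, ∀ i, boundedClass μ (A.indicator (c i)) p = A.indicator (c i) p :=
        ae_all_iff.2 fun i => boundedClass_ae_eq ((Lp.memLp (c i)).indicator hA)
      have hnn : ∀ᵐ p ∂μ, ∀ i, 0 ≤ e i p := by
        refine ae_all_iff.2 fun i => ?_
        obtain ⟨ε', hε', hb'⟩ := (h i).endowment_bounds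
        exact hb'.mono fun p hp => hε'.le.trans hp.1
      filter_upwards [hae, hnn, hb, hclear, boundedClass_indicator_ae_eq (μ := μ) hA,
        Lp.coeFn_fun_finsetSum Finset.univ fun i => boundedClass μ (A.indicator (c i)),
        Lp.coeFn_smul ε (boundedClass μ (A.indicator fun _ => (1 : ℝ)))] with
        p g1 g2 g3 g4 g5 g6 g7
      rw [g7, g6, Pi.smul_apply, g5, smul_eq_mul]
      simp only [g1]
      by_cases hp : p ∈ A
      · simp only [hp, indicator_of_mem, mul_one]
        rw [g4]
        exact g3.1.trans (Finset.single_le_sum (f := fun i => e i p) (fun i _ => g2 i)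
          (Finset.mem_univ i₀))
      · simp [hp]
    have hsum : q (∑ i, boundedClass μ (A.indicator (c i))) ≤ κ * ε := by
      rw [map_sum]
      refine (Finset.sum_le_card_nsmul _ _ _ fun i _ => hcost i).trans_eq ?_
      rw [Finset.card_univ, Fintype.card_fin, nsmul_eq_mul]
      field_simp
    rw [map_smul, smul_eq_mul] at hle
    refine le_of_mul_le_mul_left (hle.trans (hsum.trans_eq (mul_comm κ ε))) hε
  exact ⟨Q, h1, h2, h3⟩

/-- In equilibrium prices are positive. -/
theorem IsPriceDensity.ae_pos [IsFiniteMeasure μ] (hd : 0 < d) (hq : IsPositiveUnital q)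
    (h : ∀ i, IsOptimalChoice τ (U i) q (e i) (Γ i) (c i))
    (hclear : ∀ᵐ p ∂μ, ∑ i, c i p = ∑ i, e i p) {Q : X → ℝ} (hQ : IsPriceDensity q Q) :
    ∀ᵐ p ∂μ, 0 < Q p := by
  have h1 := ae_all_iff.2 fun i => (h i).ae_density_pos hq hQ
  have h2 := ae_all_iff.2 fun i => (h i).cap_gt
  filter_upwards [h1, h2, hclear] with p g1 g2 g3
  by_contra hneg
  have hne : (Finset.univ : Finset (Fin d)).Nonempty := ⟨⟨0, hd⟩, Finset.mem_univ _⟩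
  -- An agent with `c i p ≤ e i p` is below the cap, which forces `Q p > 0`. So all agents would
  -- consume more than their endowments.
  refine (Finset.sum_lt_sum_of_nonempty hne fun i _ => ?_).ne' g3
  by_contra! hle
  exact hneg (g1 i ((ENNReal.ofReal_le_ofReal hle).trans_lt (g2 i)))

end Market

/-! ### The measure `κ ⊗ P` and the optional `σ`-algebra -/

section Optional

variable {T : ℝ} {Ω : Type*} {mΩ : MeasurableSpace Ω}

theorem kappa_apply (T : ℝ) (s : Set (Time T)) :
    kappa T s = ((volume : Measure ℝ).restrict (Ico 0 T) + Measure.dirac T) (Subtype.val '' s) :=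
  (MeasurableEmbedding.subtype_coe measurableSet_Icc).comap_apply _ _

instance isFiniteMeasure_kappa (T : ℝ) : IsFiniteMeasure (kappa T) := by
  refine ⟨?_⟩
  have : IsFiniteMeasure ((volume : Measure ℝ).restrict (Ico 0 T)) :=
    ⟨by rw [Measure.restrict_apply_univ, Real.volume_Ico]; exact ENNReal.ofReal_lt_top⟩
  rw [kappa_apply]
  exact measure_lt_top _ _

theorem kappa_endTime_pos (hT : 0 < T) : 0 < kappa T {endTime hT} := by
  rw [kappa_apply, image_singleton]
  refine lt_of_lt_of_le ?_ (Measure.le_add_left le_rfl _)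
  rw [endTime, Measure.dirac_apply_of_mem (mem_singleton _)]
  exact one_pos

instance isFiniteMeasure_kappaP (𝓕 : Filtration (Time T) mΩ) (P : Measure Ω)
    [IsFiniteMeasure P] : IsFiniteMeasure (kappaP 𝓕 P) :=
  isFiniteMeasure_trim (optionalSigma_le 𝓕)

theorem measurable_optionalSigma {𝓕 : Filtration (Time T) mΩ} {Y : Time T → Ω → ℝ}
    (hY : Adapted 𝓕 Y) (hc : ∀ ω, IsCadlag fun t => Y t ω) :
    Measurable[optionalSigma 𝓕] (Function.uncurry Y) :=
  measurable_iff_comap_le.2 (le_iSup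
    (fun X : {X : Time T → Ω → ℝ // Adapted 𝓕 X ∧ ∀ ω, IsCadlag fun t => X t ω} =>
      MeasurableSpace.comap (Function.uncurry X.1) inferInstance) ⟨Y, hY, hc⟩)

theorem measurable_fst_optionalSigma (𝓕 : Filtration (Time T) mΩ) :
    Measurable[optionalSigma 𝓕] (Prod.fst : Time T × Ω → Time T) := by
  have h : Measurable[optionalSigma 𝓕]
      (Function.uncurry fun (t : Time T) (_ : Ω) => (t : ℝ)) :=
    measurable_optionalSigma (fun t => measurable_const) fun ω t =>
      ⟨continuous_subtype_val.continuousWithinAt, t,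
        (continuous_subtype_val.tendsto t).mono_left nhdsWithin_le_nhds⟩
  exact @Measurable.subtype_mk _ _ (optionalSigma 𝓕) _ _ _ h (fun p => p.1.2)

theorem IsCadlag.comp {E F : Type*} [TopologicalSpace E] [TopologicalSpace F] {x : Time T → E}
    (hx : IsCadlag x) {φ : E → F} (hφ : Continuous φ) : IsCadlag fun t => φ (x t) := fun t =>
  ⟨hφ.continuousAt.comp_continuousWithinAt (hx t).1,
    (hx t).2.imp' φ fun _ hl => (hφ.tendsto _).comp hl⟩

/-- The generators of the optional `σ`-algebra are real-valued, so `Y` is carried to the unit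
interval by a homeomorphism, which preserves limits at `∞` as well. -/
theorem measurable_optionalSigma_ennreal {𝓕 : Filtration (Time T) mΩ} {Y : Time T → Ω → ℝ≥0∞}
    (hY : Adapted 𝓕 Y) (hc : ∀ ω, IsCadlag fun t => Y t ω) :
    Measurable[optionalSigma 𝓕] (Function.uncurry Y) := by
  let φ := ENNReal.orderIsoUnitIntervalBirational.toHomeomorph
  have hφ : Continuous fun y => (φ y : ℝ) := continuous_subtype_val.comp φ.continuous
  have h : Measurable[optionalSigma 𝓕] (Function.uncurry fun t ω => (φ (Y t ω) : ℝ)) :=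
    measurable_optionalSigma (fun t => hφ.measurable.comp (hY t)) fun ω => (hc ω).comp hφ
  have h' : Measurable[optionalSigma 𝓕] fun p : Time T × Ω => φ (Y p.1 p.2) :=
    @Measurable.subtype_mk _ _ (optionalSigma 𝓕) _ _ _ h (fun p => (φ (Y p.1 p.2)).2)
  have h2 : Measurable[optionalSigma 𝓕] fun p : Time T × Ω => φ.symm (φ (Y p.1 p.2)) :=
    φ.symm.continuous.measurable.comp h'
  simp only [Homeomorph.symm_apply_apply] at h2
  exact h2

theorem IsWithdrawalCap.uncapped {hT : 0 < T} {𝓕 : Filtration (Time T) mΩ} {P : Measure Ω}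
    [IsProbabilityMeasure P] {e : Time T → Ω → ℝ} {Γ : Time T → Ω → ℝ≥0∞}
    (hΓ : IsWithdrawalCap hT 𝓕 P e Γ) : 0 < kappaP 𝓕 P {p | Function.uncurry Γ p = ∞} := by
  have hm : MeasurableSet[optionalSigma 𝓕] {p | Function.uncurry Γ p = ∞} :=
    measurable_optionalSigma_ennreal hΓ.adapted hΓ.cadlag (measurableSet_singleton ∞)
  rw [kappaP, trim_measurableSet_eq _ hm]
  have hP : P {ω | Γ (endTime hT) ω = ∞} = 1 := prob_compl_eq_zero_iff₀ (by
    exact (((hΓ.adapted _).mono (𝓕.le _) le_rfl) (measurableSet_singleton ∞)).nullMeasurableSet)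
    |>.1 hΓ.terminal
  calc 0 < (kappa T).prod P ({endTime hT} ×ˢ {ω | Γ (endTime hT) ω = ∞}) := by
        rw [Measure.prod_prod, hP, mul_one]
        exact kappa_endTime_pos hT
    _ ≤ _ := measure_mono (by
        rintro ⟨t, ω⟩ ⟨ht, hω⟩
        rw [mem_singleton_iff] at ht
        subst ht
        exact hω)

end Optional

/-! ### From the equilibrium to the optimal choices of the agents -/

section Equilibrium

variable {T : ℝ} {hT : 0 < T} {Ω : Type*} {mΩ : MeasurableSpace Ω} {P : Measure Ω}
  {𝓕 : Filtration (Time T) mΩ} {d : ℕ} {e : Fin d → Time T → Ω → ℝ}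
  {Γ : Fin d → Time T → Ω → ℝ≥0∞} {U : Fin d → Time T → ℝ → ℝ} {q : StrongDual ℝ (Linf 𝓕 P)}
  {c : Fin d → Linf 𝓕 P}

theorem IsFinAddProb.isPositiveUnital (hq : IsFinAddProb q) : IsPositiveUnital q :=
  ⟨hq.nonneg, hq.total⟩

/-- With `τ = Prod.fst`, `boundedClass` and `expectedUtility` agree by definition with `toLinf` and
`utilityFunctional`. -/
theorem IsAbstractEquilibrium.isOptimalChoice [IsProbabilityMeasure P]
    (hq : IsAbstractEquilibrium e Γ U q c) (i : Fin d)
    (he : IsEndowment 𝓕 P (e i)) (hΓ : IsWithdrawalCap hT 𝓕 P (e i) (Γ i))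
    (hU : IsRegularUtility (U i)) :
    IsOptimalChoice Prod.fst (U i) q (Function.uncurry (e i)) (Function.uncurry (Γ i)) (c i) where
  regular := hU
  measurable_time := measurable_fst_optionalSigma 𝓕
  measurable_cap := measurable_optionalSigma_ennreal hΓ.adapted hΓ.cadlag
  uncapped := hΓ.uncapped
  measurable_endowment := he.optional
  endowment_bounds := he.bounds
  cap_gt := hΓ.gt_endowment
  admissible := (hq.budget i).1
  budget := (hq.budget i).2
  optimal x hx hqx := hq.optimal i x ⟨hx, hqx⟩

theorem IsAbstractEquilibrium.ae_sum_eq (hq : IsAbstractEquilibrium e Γ U q c)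
    (h : ∀ i, IsOptimalChoice Prod.fst (U i) q (Function.uncurry (e i)) (Function.uncurry (Γ i))
      (c i)) :
    ∀ᵐ p ∂(kappaP 𝓕 P), ∑ i, c i p = ∑ i, Function.uncurry (e i) p := by
  have he : ∀ᵐ p ∂(kappaP 𝓕 P), ∀ i,
      boundedClass (kappaP 𝓕 P) (Function.uncurry (e i)) p = Function.uncurry (e i) p :=
    ae_all_iff.2 fun i => boundedClass_ae_eq (h i).memLp_endowment
  have hcl : ∑ i, c i = ∑ i, boundedClass (kappaP 𝓕 P) (Function.uncurry (e i)) := hq.clearing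
  filter_upwards [he, Lp.coeFn_fun_finsetSum Finset.univ c, Lp.coeFn_fun_finsetSum Finset.univ
    fun i => boundedClass (kappaP 𝓕 P) (Function.uncurry (e i))] with p h1 h2 h3
  rw [← h2, hcl, h3]
  exact Finset.sum_congr rfl fun i _ => h1 i

theorem IsOptionalDensity.isPriceDensity {Q : Time T × Ω → ℝ} (hQ : IsOptionalDensity q Q) :
    IsPriceDensity q Q :=
  ⟨hQ.optional, hQ.integrable, hQ.density⟩

end Equilibrium

end AbstractEquilibrium

theorem mainTheorem8 {T : ℝ} (hT : 0 < T) {Ω : Type*} {mΩ : MeasurableSpace Ω}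
    (P : Measure Ω) [IsProbabilityMeasure P] (𝓕 : Filtration (Time T) mΩ)
    (h𝓕 : IsStandardFiltration hT 𝓕 P)
    {d : ℕ} (hd : 0 < d)
    (e : Fin d → Time T → Ω → ℝ) (he : ∀ i, IsEndowment 𝓕 P (e i))
    (Γ : Fin d → Time T → Ω → ℝ≥0∞) (hΓ : ∀ i, IsWithdrawalCap hT 𝓕 P (e i) (Γ i))
    (U : Fin d → Time T → ℝ → ℝ) (hU : ∀ i, IsRegularUtility (U i))
    (q : StrongDual ℝ (Linf 𝓕 P)) (c : Fin d → Linf 𝓕 P)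
    (hq : IsAbstractEquilibrium e Γ U q c) :
    (∃ Q : Time T × Ω → ℝ, IsOptionalDensity q Q) ∧
    ∃ lam : Fin d → ℝ, (∀ i, 0 < lam i) ∧
      ∀ Q : Time T × Ω → ℝ, IsOptionalDensity q Q →
        (∀ᵐ p ∂(kappaP 𝓕 P), 0 < Q p) ∧
        ∀ i, ∀ᵐ p ∂(kappaP 𝓕 P),
          ENNReal.ofReal (c i p) =
            min (Γ i p.1 p.2) (ENNReal.ofReal (invMarginal (U i) p.1 (lam i * Q p))) := by
  have hopt := fun i => hq.isOptimalChoice i (he i) (hΓ i) (hU i)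
  have hclear := hq.ae_sum_eq hopt
  have hpu := hq.probability.isPositiveUnital
  obtain ⟨Q₀, hQ₀⟩ := exists_isPriceDensity hd hpu hopt hclear
  have hpos := hQ₀.ae_pos hd hpu hopt hclear
  choose lam hlam hfoc using fun i => (hopt i).exists_multiplier hpu hQ₀ hpos
  refine ⟨⟨Q₀, hQ₀.measurable, hQ₀.integrable, hQ₀.mass_eq⟩, lam, hlam, fun Q hQ => ?_⟩
  refine ⟨hQ.isPriceDensity.ae_pos hd hpu hopt hclear, fun i => ?_⟩
  -- Densities are unique almost everywhere, so the multipliers found for `Q₀` serve every density.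
  have hae : Q =ᵐ[kappaP 𝓕 P] Q₀ :=
    hQ.integrable.ae_eq_of_forall_setIntegral_eq Q Q₀ hQ₀.integrable fun A hA _ =>
      (hQ.density A hA).symm.trans (hQ₀.mass_eq A hA)
  filter_upwards [hfoc i, hae] with p h1 h2
  rw [h2]
  exact h1
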